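/- Let $R$ be an associative ring with unity $1$, not necessarily commutative, and let $m\ge 1$. Let $T_\infty(m,R)$ denote the set of upper triangular $\mathbb N\times\mathbb N$ matrices over $R$ whose entries on the first $m-1$ superdiagonals are all zero, and $T_n(m,R)$ the corresponding set of $n\times n$ matrices. For $\ast=\infty$ or $\ast=n\in\mathbb N$ and $s\in\mathbb N$ put $$UT_\ast(m,R)=\{g\in T_\ast(m,R): g_{ii}=1 \text{ for all } i\},$$ $$UT^{(s)}_\ast(m,R)=\{g\in T_\ast(m,R): g_{ii}^s=1\text{ for all } i\},$$ $$\pm UT^{(s)}_\ast(m,R)=\{g\in T_\ast(m,R): g_{ii}^s\in\{1,-1\}\text{ for all } i\}.$$ An element $B$ of one of these sets is called an involution if $B^2=I$, a skew-involution if $B^2=-I$, of order $s$ if $B^s=I$, and of skew order $s$ if $B^s=-I$. Commutators are $[B,C]=BCB^{-1}C^{-1}$. **Theorem.** Let $\ast=\infty$ or $\ast=n\in\mathbb N$, and let $A\in UT_\ast(m,R)$. 1. If $2$ is invertible in $R$, then $A$ is a product of at most two commutators $[B,C]$ of involutions $B,C\in\pm UT^{(2)}_\ast(m,R)$. 2.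 If $2$ is invertible in $R$ and the center of $R$ contains an element $\iota$ with $\iota^2=-1$, then $A$ is a product of at most two commutators $[B,C]$ with $B$ a skew-involution and $C$ an involution, both in $\pm UT^{(2)}_\ast(m,R)$. 3. Let $k\ge 2$. If $k$ is invertible in $R$ and the center of $R$ contains a $k$-th root of unity $\omega$ with $1+\omega+\dots+\omega^{k-1}=0$, then $A$ is a product of at most $4k-6$ commutators $[B,C]$ of matrices $B,C\in UT^{(k)}_\ast(m,R)$ of order $k$. 4. Let $k\ge 2$. If $2k$ is invertible in $R$ and the center of $R$ contains an element $\zeta$ with $\zeta^{2k}=-1$, then $A$ is a product of at most $8k-6$ commutators $[B,C]$ with $B$ of skew order $2k$ and $C$ of order $2k$, both in $\pm UT^{(2k)}_\ast(m,R)$. -/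

import Mathlib

/-!
Infinite upper triangular matrices over `R`, with rows and columns indexed by `ℕ`, are the elements
of `IncidenceAlgebra R ℕ`: functions `g : ℕ → ℕ → R` with `g i j = 0` unless `i ≤ j`, multiplied by
`(g * h) i j = ∑ l ∈ Finset.Icc i j, g i l * h l j`, which is the matrix product. Finite matrices
are `Matrix (Fin n) (Fin n) R`. The ring `R` need not be commutative.
-/

section Generic

variable {M : Type*} [Ring M]

/-- `A` is a commutator `B C B⁻¹ C⁻¹` of an invertible element `B` with property `P` and an
invertible element `C` with property `Q`. -/
def IsCommutatorOf (P Q : M → Prop) (A : M) : Prop :=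
  ∃ B C : Mˣ, P (B : M) ∧ Q (C : M) ∧ A = ((B * C * B⁻¹ * C⁻¹ : Mˣ) : M)

/-- `A` is a product of at most `r` commutators `B C B⁻¹ C⁻¹`, where each `B` has property `P`
and each `C` has property `Q`. -/
def IsProdOfCommutators (r : ℕ) (P Q : M → Prop) (A : M) : Prop :=
  ∃ l : List M, l.length ≤ r ∧ (∀ x ∈ l, IsCommutatorOf P Q x) ∧ l.prod = A

/-- `B` lies in the set `S` and has order `s`, in the sense `B ^ s = 1`
(an involution for `s = 2`). -/
def HasOrderIn (S : Set M) (s : ℕ) (B : M) : Prop := B ∈ S ∧ B ^ s = 1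

/-- `B` lies in the set `S` and has skew order `s`, that is `B ^ s = -1`
(a skew-involution for `s = 2`). -/
def HasSkewOrderIn (S : Set M) (s : ℕ) (B : M) : Prop := B ∈ S ∧ B ^ s = -1

end Generic

section Infinite

variable (R : Type*) [Ring R]

/-- `T_∞(m, R)`: upper triangular infinite matrices that vanish on the first `m - 1`
superdiagonals. (Invertibility is imposed where the elements are used: it is automatic when the
diagonal entries are roots of `±1`.) -/
def TInf (m : ℕ) : Set (IncidenceAlgebra R ℕ) :=
  {g | ∀ i j : ℕ, i < j → j < i + m → g i j = 0}

/-- `UT_∞(m, R)`: the elements of `T_∞(m, R)` with all diagonal entries equal to `1`. -/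
def UTInf (m : ℕ) : Set (IncidenceAlgebra R ℕ) :=
  {g | g ∈ TInf R m ∧ ∀ i, g i i = 1}

/-- `UT_∞^{(s)}(m, R)`: the elements of `T_∞(m, R)` whose diagonal entries are `s`-th roots
of `1`. -/
def UTRootInf (s m : ℕ) : Set (IncidenceAlgebra R ℕ) :=
  {g | g ∈ TInf R m ∧ ∀ i, (g i i) ^ s = 1}

/-- `± UT_∞^{(s)}(m, R)`: the elements of `T_∞(m, R)` whose diagonal entries have `s`-th power
`1` or `-1`. -/
def PMUTInf (s m : ℕ) : Set (IncidenceAlgebra R ℕ) :=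
  {g | g ∈ TInf R m ∧ ∀ i, (g i i) ^ s = 1 ∨ (g i i) ^ s = -1}

end Infinite

section Finite

variable (R : Type*) [Ring R]

/-- `T_n(m, R)`: upper triangular `n × n` matrices that vanish on the first `m - 1`
superdiagonals. -/
def TFin (n m : ℕ) : Set (Matrix (Fin n) (Fin n) R) :=
  {g | (∀ i j : Fin n, j < i → g i j = 0) ∧
    ∀ i j : Fin n, i < j → (j : ℕ) < (i : ℕ) + m → g i j = 0}

/-- `UT_n(m, R)`. -/
def UTFin (n m : ℕ) : Set (Matrix (Fin n) (Fin n) R) :=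
  {g | g ∈ TFin R n m ∧ ∀ i, g i i = 1}

/-- `UT_n^{(s)}(m, R)`. -/
def UTRootFin (n s m : ℕ) : Set (Matrix (Fin n) (Fin n) R) :=
  {g | g ∈ TFin R n m ∧ ∀ i, (g i i) ^ s = 1}

/-- `± UT_n^{(s)}(m, R)`. -/
def PMUTFin (n s m : ℕ) : Set (Matrix (Fin n) (Fin n) R) :=
  {g | g ∈ TFin R n m ∧ ∀ i, (g i i) ^ s = 1 ∨ (g i i) ^ s = -1}

end Finite

/-!
Let `S` be the ring of `m × m` matrices over `R`. Cutting an infinite matrix `A ∈ UT_∞(m, R)` into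
`m × m` blocks turns it into a unipotent upper triangular matrix over `S`, whose first superdiagonal
consists of upper triangular blocks; conversely, the matrices over `S` with scalar diagonal blocks
and with upper triangular blocks on the first superdiagonal (`bandSubring`, `bandUnipotent`) unfold
to elements of `T_∞(m, R)` (`blockHom`). So it is enough to work over an abstract ring `S`, with
`m = 1` and with the entries of the first superdiagonal restricted to a subring `S₀`. Conjugation by
unipotent matrices that vanish on the first superdiagonal is harmless for every `S₀`.

A unipotent matrix that vanishes on the first superdiagonal and has ones on the second and zeros on
the third is conjugate to a fixed matrix. This is a case of `exists_conj_blockShift`, which finds the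
rows of the conjugating matrix one pair after the other.

If `ω ^ k = 1` and `1 - ω` is invertible, then `1 + x` is a commutator of two elements of order `k`
whenever `x` has its nonzero entries only in rows from a set `P` and columns outside `P`
(`isCommutatorOf_one_add`); a diagonal matrix with entries `ω` on `P` is one of the two. With `P` the
indices of given parity, or those congruent to `0, 1` modulo `4`, four such commutators bring `A` into
the normal form above, and the normal form is a product of two commutators. This makes six
(`isProdOfCommutators_six`), and `6 ≤ 4 k - 6` for `k ≥ 3`.

For `k = 2` only two commutators are allowed (`isProdOfCommutators_two`). When `2` is invertible,
unipotent matrices have unipotent square roots, and a unipotent matrix inverted by an involution is a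
commutator of two involutions (`isCommutatorOf_of_inverted`). A product of two unipotent matrices
inverted by the same involution is inverted by some involution too. Moreover, the Cayley transform
`(1 + h) (1 - h)⁻¹` is inverted by a diagonal matrix of signs that anticommutes with `h`. The signs
`+ - - +` (period four) give factors `Y` and `Z` for which `A Y Z` is conjugate to the Cayley
transform of half a block shift, and the latter is inverted by the signs `+ + - -`.

The finite case follows, as the leading `n × n` corner is a ring homomorphism on upper triangular
infinite matrices. Elements of skew order `s` are
obtained from elements of order `s` by multiplication with a central element whose `s`-th power is
`-1`, which does not change commutators; if `ζ ^ (2 k) = -1`, then `ζ ^ 2` serves as the root `ω` for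
the order `2 k`.
-/

/-! ### Entries of products in the incidence algebra of `ℕ` -/

section Entries

variable {S : Type*} [Ring S]

local notation "𝕌" => IncidenceAlgebra S ℕ

lemma incidence_mul_self (f g : 𝕌) (i : ℕ) : (f * g) i i = f i i * g i i := by
  simp

lemma incidence_mul_one (f g : 𝕌) (i : ℕ) :
    (f * g) i (i + 1) = f i i * g i (i + 1) + f i (i + 1) * g (i + 1) (i + 1) := by
  rw [IncidenceAlgebra.mul_apply, Finset.sum_Icc_succ_top (by omega), Finset.Icc_self,
    Finset.sum_singleton]

lemma incidence_mul_two (f g : 𝕌) (i : ℕ) :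
    (f * g) i (i + 2) = f i i * g i (i + 2) + f i (i + 1) * g (i + 1) (i + 2)
      + f i (i + 2) * g (i + 2) (i + 2) := by
  rw [IncidenceAlgebra.mul_apply, Finset.sum_Icc_succ_top (by omega),
    Finset.sum_Icc_succ_top (by omega), Finset.Icc_self, Finset.sum_singleton]

lemma incidence_mul_three (f g : 𝕌) (i : ℕ) :
    (f * g) i (i + 3) = f i i * g i (i + 3) + f i (i + 1) * g (i + 1) (i + 3)
      + f i (i + 2) * g (i + 2) (i + 3) + f i (i + 3) * g (i + 3) (i + 3) := by
  rw [IncidenceAlgebra.mul_apply, Finset.sum_Icc_succ_top (by omega),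
    Finset.sum_Icc_succ_top (by omega), Finset.sum_Icc_succ_top (by omega), Finset.Icc_self,
    Finset.sum_singleton]

lemma incidence_mul_four (f g : 𝕌) (i : ℕ) :
    (f * g) i (i + 4) = f i i * g i (i + 4) + f i (i + 1) * g (i + 1) (i + 4)
      + f i (i + 2) * g (i + 2) (i + 4) + f i (i + 3) * g (i + 3) (i + 4)
      + f i (i + 4) * g (i + 4) (i + 4) := by
  rw [IncidenceAlgebra.mul_apply, Finset.sum_Icc_succ_top (by omega),
    Finset.sum_Icc_succ_top (by omega), Finset.sum_Icc_succ_top (by omega),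
    Finset.sum_Icc_succ_top (by omega), Finset.Icc_self, Finset.sum_singleton]

lemma incidence_mul_five (f g : 𝕌) (i : ℕ) :
    (f * g) i (i + 5) = f i i * g i (i + 5) + f i (i + 1) * g (i + 1) (i + 5)
      + f i (i + 2) * g (i + 2) (i + 5) + f i (i + 3) * g (i + 3) (i + 5)
      + f i (i + 4) * g (i + 4) (i + 5) + f i (i + 5) * g (i + 5) (i + 5) := by
  rw [IncidenceAlgebra.mul_apply, Finset.sum_Icc_succ_top (by omega),
    Finset.sum_Icc_succ_top (by omega), Finset.sum_Icc_succ_top (by omega),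
    Finset.sum_Icc_succ_top (by omega), Finset.sum_Icc_succ_top (by omega), Finset.Icc_self,
    Finset.sum_singleton]

/-- The diagonal matrix with diagonal entries `d i`. -/
def incidenceDiagonal (d : ℕ → S) : 𝕌 :=
  ⟨fun i j ↦ if i = j then d i else 0, fun _ _ h ↦ if_neg fun e ↦ h e.le⟩

/-- The upper triangular matrix whose entries on and above the diagonal are those of `f`. -/
def incidenceOfFun (f : ℕ → ℕ → S) : 𝕌 :=
  ⟨fun i j ↦ if i ≤ j then f i j else 0, fun _ _ h ↦ if_neg h⟩

lemma incidenceDiagonal_apply (d : ℕ → S) (i j : ℕ) :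
    incidenceDiagonal d i j = if i = j then d i else 0 := rfl

lemma incidenceOfFun_apply (f : ℕ → ℕ → S) {i j : ℕ} (h : i ≤ j) :
    incidenceOfFun f i j = f i j := if_pos h

lemma incidenceDiagonal_mul (d : ℕ → S) (f : 𝕌) (i j : ℕ) :
    (incidenceDiagonal d * f) i j = d i * f i j := by
  rw [IncidenceAlgebra.mul_apply]
  by_cases h : i ≤ j
  · rw [Finset.sum_eq_single i]
    · simp [incidenceDiagonal_apply]
    · intro b _ hb
      simp [incidenceDiagonal_apply, hb.symm]
    · intro hi
      exact absurd (Finset.mem_Icc.2 ⟨le_rfl, h⟩) hi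
  · rw [Finset.Icc_eq_empty h, IncidenceAlgebra.apply_eq_zero_of_not_le h]
    simp

lemma mul_incidenceDiagonal (d : ℕ → S) (f : 𝕌) (i j : ℕ) :
    (f * incidenceDiagonal d) i j = f i j * d j := by
  rw [IncidenceAlgebra.mul_apply]
  by_cases h : i ≤ j
  · rw [Finset.sum_eq_single j]
    · simp [incidenceDiagonal_apply]
    · intro b _ hb
      simp [incidenceDiagonal_apply, hb]
    · intro hi
      exact absurd (Finset.mem_Icc.2 ⟨h, le_rfl⟩) hi
  · rw [Finset.Icc_eq_empty h, IncidenceAlgebra.apply_eq_zero_of_not_le h]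
    simp

lemma incidenceDiagonal_pow (d : ℕ → S) (k : ℕ) :
    incidenceDiagonal d ^ k = incidenceDiagonal fun i ↦ d i ^ k := by
  induction k with
  | zero => ext i j _; simp [incidenceDiagonal_apply]
  | succ k ih =>
    ext i j _
    rw [pow_succ, ih, mul_incidenceDiagonal]
    by_cases h : i = j
    · subst h; simp [incidenceDiagonal_apply, pow_succ]
    · simp [incidenceDiagonal_apply, h]

/-- A matrix can be defined by recursion on the distance `j - i` of an entry from the diagonal. -/
lemma exists_incidence_fixpoint (F : (ℕ → ℕ → S) → ℕ → ℕ → S)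
    (hF : ∀ (f g : ℕ → ℕ → S) (i j : ℕ),
      (∀ a b, a ≤ b → b - a < j - i → f a b = g a b) → F f i j = F g i j) :
    ∃ f : 𝕌, ∀ i j, i ≤ j → f i j = F (fun a b ↦ f a b) i j := by
  set s : ℕ → ℕ → ℕ → S := fun n ↦ F^[n] 0 with hs
  have hsucc : ∀ n, s (n + 1) = F (s n) := fun n ↦ Function.iterate_succ_apply' F n 0
  have hstab : ∀ n m i j, j - i < n → j - i < m → s n i j = s m i j := by
    intro n
    induction n with
    | zero => intro m i j h; omega
    | succ n ih =>
      intro m i j h hm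
      obtain ⟨m, rfl⟩ : ∃ m', m = m' + 1 := ⟨m - 1, by omega⟩
      rw [hsucc n, hsucc m]
      exact hF _ _ _ _ fun a b _ hlt ↦ ih m a b (by omega) (by omega)
  refine ⟨incidenceOfFun fun i j ↦ s (j - i + 1) i j, fun i j hij ↦ ?_⟩
  rw [incidenceOfFun_apply _ hij, hsucc]
  refine hF _ _ _ _ fun a b hab hlt ↦ ?_
  rw [incidenceOfFun_apply _ hab]
  exact hstab _ _ _ _ hlt (by omega)

end Entries

/-! ### Unipotent matrices with restricted first superdiagonal -/

section Band

variable {S : Type*} [Ring S]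

local notation "𝕌" => IncidenceAlgebra S ℕ

/-- Upper triangular matrices over `S` with central diagonal entries and with first superdiagonal
in the subring `S₀`. When `S` is a ring of `m × m` matrices and `S₀` consists of the upper
triangular ones, these matrices unfold to matrices that vanish on the first `m - 1`
superdiagonals. -/
def bandSubring (S₀ : Subring S) (hS₀ : Subring.center S ≤ S₀) : Subring 𝕌 where
  carrier := {f | ∀ i, f i i ∈ Subring.center S ∧ f i (i + 1) ∈ S₀}
  mul_mem' {f g} hf hg i := by
    rw [incidence_mul_self, incidence_mul_one]
    exact ⟨mul_mem (hf i).1 (hg i).1, add_mem (mul_mem (hS₀ (hf i).1) (hg i).2)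
      (mul_mem (hf i).2 (hS₀ (hg (i + 1)).1))⟩
  one_mem' i := by simp [one_mem, zero_mem]
  add_mem' {f g} hf hg i := ⟨add_mem (hf i).1 (hg i).1, add_mem (hf i).2 (hg i).2⟩
  zero_mem' i := ⟨zero_mem _, zero_mem _⟩
  neg_mem' {f} hf i := ⟨neg_mem (hf i).1, neg_mem (hf i).2⟩

variable {S₀ : Subring S} {hS₀ : Subring.center S ≤ S₀}

lemma incidenceDiagonal_mem_bandSubring {d : ℕ → S} (hd : ∀ i, d i ∈ Subring.center S) :
    incidenceDiagonal d ∈ bandSubring S₀ hS₀ := fun i ↦ by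
  simp [incidenceDiagonal_apply, hd i, zero_mem]

lemma exists_left_inverse_of_unipotent (f : 𝕌) (hf : ∀ i, f i i = 1) :
    ∃ g : 𝕌, g * f = 1 ∧ ∀ i, g i i = 1 := by
  obtain ⟨g, hg⟩ := exists_incidence_fixpoint
    (fun g i j ↦ (1 : 𝕌) i j - ∑ x ∈ Finset.Ico i j, g i x * f x j) (by
      intro g g' i j h
      refine congrArg _ (Finset.sum_congr rfl fun x hx ↦ ?_)
      rw [Finset.mem_Ico] at hx
      simp only [h i x (by omega) (by omega)])
  refine ⟨g, ?_, fun i ↦ by simp [hg i i le_rfl]⟩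
  ext i j hij
  rw [IncidenceAlgebra.mul_apply, ← Finset.Ico_insert_right hij,
    Finset.sum_insert Finset.right_notMem_Ico, hf, mul_one, hg i j hij]
  abel

lemma exists_unit_of_unipotent (f : 𝕌) (hf : ∀ i, f i i = 1) : ∃ u : 𝕌ˣ, (u : 𝕌) = f := by
  obtain ⟨g, hgf, hg⟩ := exists_left_inverse_of_unipotent f hf
  obtain ⟨f', hf', -⟩ := exists_left_inverse_of_unipotent g hg
  have : f' = f := left_inv_eq_right_inv hf' hgf
  exact ⟨⟨f, g, this ▸ hf', hgf⟩, rfl⟩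

/-- The unipotent upper triangular matrices over `S` with first superdiagonal in `S₀`. -/
def bandUnipotent (S₀ : Subring S) (hS₀ : Subring.center S ≤ S₀) : Subgroup 𝕌ˣ where
  carrier := {u | (∀ i, (u : 𝕌) i i = 1) ∧ (u : 𝕌) ∈ bandSubring S₀ hS₀}
  mul_mem' {u v} hu hv := by
    refine ⟨fun i ↦ ?_, mul_mem hu.2 hv.2⟩
    rw [Units.val_mul, incidence_mul_self, hu.1, hv.1, mul_one]
  one_mem' := ⟨fun i ↦ by simp, one_mem _⟩
  inv_mem' {u} hu := by
    have h1 : ∀ i, ((u⁻¹ : 𝕌ˣ) : 𝕌) i i = 1 := fun i ↦ by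
      have h : ((u : 𝕌) * (u⁻¹ : 𝕌ˣ)) i i = (1 : 𝕌) i i := by rw [u.mul_inv]
      rw [incidence_mul_self, hu.1, one_mul] at h
      simpa using h
    refine ⟨h1, fun i ↦ ⟨by simp [h1 i, one_mem], ?_⟩⟩
    have h := congrArg (fun f : 𝕌 ↦ f i (i + 1)) u.mul_inv
    simp only [incidence_mul_one, hu.1 i, h1, one_mul, mul_one, IncidenceAlgebra.one_apply] at h
    rw [if_neg (by omega)] at h
    rw [eq_neg_of_add_eq_zero_left h]
    exact neg_mem (hu.2 i).2

lemma exists_mem_bandUnipotent (hS₀ : Subring.center S ≤ S₀) (f : 𝕌) (hf : ∀ i, f i i = 1)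
    (hf1 : ∀ i, f i (i + 1) ∈ S₀) : ∃ u ∈ bandUnipotent S₀ hS₀, (u : 𝕌) = f := by
  obtain ⟨u, rfl⟩ := exists_unit_of_unipotent f hf
  exact ⟨u, ⟨hf, fun i ↦ ⟨by simp [hf i, one_mem], hf1 i⟩⟩, rfl⟩

end Band

/-! ### Square roots of unipotent matrices -/

section Sqrt

variable {S : Type*} [Ring S] {S₀ : Subring S} {hS₀ : Subring.center S ≤ S₀}

local notation "𝕌" => IncidenceAlgebra S ℕ

lemma incidence_mul_eq_add_Ioo (f g : 𝕌) (i j : ℕ) (h : i < j) :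
    (f * g) i j = f i i * g i j + f i j * g j j + ∑ x ∈ Finset.Ioo i j, f i x * g x j := by
  rw [IncidenceAlgebra.mul_apply, ← Finset.Ico_insert_right h.le,
    Finset.sum_insert Finset.right_notMem_Ico, ← Finset.Ioo_insert_left h,
    Finset.sum_insert Finset.left_notMem_Ioo]
  abel

/-- The entry `y i j` of the square root `y` of `x` is `1 / 2 = t` times the difference of `x i j` and
an expression in the entries of `y` closer to the diagonal. -/
lemma exists_sqrt_of_unipotent {t : S} (ht : t ∈ Subring.center S) (h2 : t + t = 1)
    {x : 𝕌ˣ} (hx : x ∈ bandUnipotent S₀ hS₀) :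
    ∃ y ∈ bandUnipotent S₀ hS₀, y * y = x := by
  obtain ⟨f, hf⟩ := exists_incidence_fixpoint
    (fun f i j ↦ if i = j then 1 else
      t * ((x : 𝕌) i j - ∑ l ∈ Finset.Ioo i j, f i l * f l j)) (by
      intro f g i j h
      split_ifs
      · rfl
      · congr 2
        refine Finset.sum_congr rfl fun l hl ↦ ?_
        rw [Finset.mem_Ioo] at hl
        rw [h i l (by omega) (by omega), h l j (by omega) (by omega)])
  have hf0 : ∀ i, f i i = 1 := fun i ↦ by simp [hf i i le_rfl]
  obtain ⟨y, hy, hyf⟩ := exists_mem_bandUnipotent hS₀ f hf0 (fun i ↦ by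
    rw [hf i (i + 1) (by omega), if_neg (by omega), Finset.sum_eq_zero (by
      intro l hl; rw [Finset.mem_Ioo] at hl; omega), sub_zero]
    exact mul_mem (hS₀ ht) (hx.2 i).2)
  refine ⟨y, hy, Units.ext ?_⟩
  rw [Units.val_mul, hyf]
  ext i j hij
  rcases hij.eq_or_lt with rfl | hlt
  · rw [incidence_mul_self, hf0, hx.1, one_mul]
  · rw [incidence_mul_eq_add_Ioo _ _ _ _ hlt, hf0, hf0, one_mul, mul_one]
    have h := hf i j hij
    rw [if_neg hlt.ne] at h
    have h3 : f i j + f i j = (x : 𝕌) i j - ∑ l ∈ Finset.Ioo i j, f i l * f l j := by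
      conv_lhs => rw [h]
      rw [← add_mul, h2, one_mul]
    rw [h3]
    abel

lemma sqrt_unique_of_unipotent {t : S} (h2 : t + t = 1) {y z : 𝕌} (hy : ∀ i, y i i = 1)
    (hz : ∀ i, z i i = 1) (h : y * y = z * z) : y = z := by
  have key : ∀ n i j, j - i = n → i ≤ j → y i j = z i j := by
    intro n
    induction n using Nat.strong_induction_on with
    | _ n ih =>
      intro i j hn hij
      rcases hij.eq_or_lt with rfl | hlt
      · rw [hy, hz]
      · have e := congrArg (fun f : 𝕌 ↦ f i j) h
        simp only [incidence_mul_eq_add_Ioo _ _ _ _ hlt, hy, hz, one_mul, mul_one] at e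
        have hs : ∑ l ∈ Finset.Ioo i j, y i l * y l j = ∑ l ∈ Finset.Ioo i j, z i l * z l j :=
          Finset.sum_congr rfl fun l hl ↦ by
            rw [Finset.mem_Ioo] at hl
            rw [ih (l - i) (by omega) i l rfl hl.1.le, ih (j - l) (by omega) l j rfl hl.2.le]
        rw [hs] at e
        have e' := add_right_cancel e
        calc y i j = t * (y i j + y i j) := by rw [mul_add, ← add_mul, h2, one_mul]
          _ = t * (z i j + z i j) := by rw [e']
          _ = z i j := by rw [mul_add, ← add_mul, h2, one_mul]
  ext i j hij
  exact key _ i j rfl hij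

end Sqrt

/-! ### Elements inverted by an involution -/

section Involutions

variable {S : Type*} [Ring S] {S₀ : Subring S} {hS₀ : Subring.center S ≤ S₀}

local notation "𝕌" => IncidenceAlgebra S ℕ

lemma IsCommutatorOf.conj {M : Type*} [Ring M] (T : Subring M) {k : ℕ} {g x : Mˣ}
    (hg : (g : M) ∈ T) (hg' : ((g⁻¹ : Mˣ) : M) ∈ T)
    (h : IsCommutatorOf (HasOrderIn (T : Set M) k) (HasOrderIn (T : Set M) k) (x : M)) :
    IsCommutatorOf (HasOrderIn (T : Set M) k) (HasOrderIn (T : Set M) k)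
      ((g * x * g⁻¹ : Mˣ) : M) := by
  obtain ⟨B, C, hB, hC, hx⟩ := h
  have aux : ∀ D : Mˣ, HasOrderIn (T : Set M) k (D : M) →
      HasOrderIn (T : Set M) k ((g * D * g⁻¹ : Mˣ) : M) := fun D hD ↦ by
    refine ⟨mul_mem (mul_mem hg hD.1) hg', ?_⟩
    rw [← Units.val_pow_eq_pow_val, conj_pow]
    have : D ^ k = 1 := Units.ext (by simpa using hD.2)
    simp [this]
  refine ⟨g * B * g⁻¹, g * C * g⁻¹, aux B hB, aux C hC, congrArg Units.val ?_⟩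
  rw [Units.ext hx]
  group

/-- The square root of a unipotent matrix inverted by an involution is inverted by it too. -/
lemma exists_sqrt_inverted {t : S} (ht : t ∈ Subring.center S) (h2 : t + t = 1)
    {x σ : 𝕌ˣ} (hx : x ∈ bandUnipotent S₀ hS₀) (hσ2 : σ * σ = 1) (h : σ * x * σ = x⁻¹) :
    ∃ y ∈ bandUnipotent S₀ hS₀, y * y = x ∧ σ * y * σ = y⁻¹ := by
  obtain ⟨y, hy, hyx⟩ := exists_sqrt_of_unipotent ht h2 hx
  refine ⟨y, hy, hyx, ?_⟩
  have hy' := inv_mem hy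
  have hinv : σ⁻¹ = σ := inv_eq_of_mul_eq_one_right hσ2
  have hsq : (σ * y * σ) * (σ * y * σ) = y⁻¹ * y⁻¹ := by
    calc (σ * y * σ) * (σ * y * σ) = σ * y * (σ * σ) * y * σ := by group
      _ = σ * (y * y) * σ := by rw [hσ2]; group
      _ = y⁻¹ * y⁻¹ := by rw [hyx, h, ← hyx]; group
  refine Units.ext (sqrt_unique_of_unipotent h2 (fun i ↦ ?_) hy'.1 ?_)
  · rw [Units.val_mul, Units.val_mul, incidence_mul_self, incidence_mul_self, hy.1, mul_one,
      ← incidence_mul_self, ← Units.val_mul, hσ2]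
    simp
  · rw [← Units.val_mul, hsq, Units.val_mul]

/-- A unipotent matrix `x` inverted by an involution `σ` is the commutator `[y σ, σ]`, where `y` is
the unipotent square root of `x`. -/
lemma isCommutatorOf_of_inverted {t : S} (ht : t ∈ Subring.center S) (h2 : t + t = 1)
    {x σ : 𝕌ˣ} (hx : x ∈ bandUnipotent S₀ hS₀) (hσ : (σ : 𝕌) ∈ bandSubring S₀ hS₀)
    (hσ2 : σ * σ = 1) (h : σ * x * σ = x⁻¹) :
    IsCommutatorOf (HasOrderIn (bandSubring S₀ hS₀ : Set 𝕌) 2)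
      (HasOrderIn (bandSubring S₀ hS₀ : Set 𝕌) 2) (x : 𝕌) := by
  obtain ⟨y, hy, hyx, hyσ⟩ := exists_sqrt_inverted ht h2 hx hσ2 h
  have hinv : σ⁻¹ = σ := inv_eq_of_mul_eq_one_right hσ2
  have hB : (y * σ) * (y * σ) = 1 := by
    calc (y * σ) * (y * σ) = y * (σ * y * σ) := by group
      _ = 1 := by rw [hyσ]; group
  have hBinv : (y * σ)⁻¹ = y * σ := inv_eq_of_mul_eq_one_right hB
  refine ⟨y * σ, σ, ⟨mul_mem hy.2 hσ, ?_⟩, ⟨hσ, ?_⟩, congrArg Units.val ?_⟩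
  · rw [pow_two, ← Units.val_mul, hB, Units.val_one]
  · rw [pow_two, ← Units.val_mul, hσ2, Units.val_one]
  · calc x = y * y := hyx.symm
      _ = y * (σ * σ) * y * (σ * σ) := by rw [hσ2]; group
      _ = y * σ * σ * (y * σ) * σ := by group
      _ = y * σ * σ * (y * σ)⁻¹ * σ⁻¹ := by rw [hBinv, hinv]

/-- A product `y z` of two unipotent matrices inverted by the same involution is inverted by an
involution as well: with `s` the square root of `y`, it is conjugate to `s z s`. -/
lemma exists_involution_mul_inverted {t : S} (ht : t ∈ Subring.center S) (h2 : t + t = 1)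
    {y z σ : 𝕌ˣ} (hy : y ∈ bandUnipotent S₀ hS₀) (hσ : (σ : 𝕌) ∈ bandSubring S₀ hS₀)
    (hσ2 : σ * σ = 1) (hyσ : σ * y * σ = y⁻¹) (hzσ : σ * z * σ = z⁻¹) :
    ∃ τ : 𝕌ˣ, (τ : 𝕌) ∈ bandSubring S₀ hS₀ ∧ τ * τ = 1 ∧ τ * (y * z) * τ = (y * z)⁻¹ := by
  obtain ⟨s, hs, rfl, hsσ⟩ := exists_sqrt_inverted ht h2 hy hσ2 hyσ
  refine ⟨s * σ * s⁻¹, mul_mem (mul_mem hs.2 hσ) (inv_mem hs).2, ?_, ?_⟩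
  · calc s * σ * s⁻¹ * (s * σ * s⁻¹) = s * (σ * σ) * s⁻¹ := by group
      _ = 1 := by rw [hσ2]; group
  · calc s * σ * s⁻¹ * (s * s * z) * (s * σ * s⁻¹)
        = s * (σ * s * (1 * z * 1) * s * σ) * s⁻¹ := by group
      _ = s * ((σ * s * σ) * (σ * z * σ) * (σ * s * σ)) * s⁻¹ := by
        rw [← hσ2]; group
      _ = (s * s * z)⁻¹ := by rw [hsσ, hzσ]; group

end Involutions

/-! ### Transvection-like matrices as commutators of elements of order `k` -/

section Transvections

/-- If `y D = y` and `y ^ 2 = 0`, the commutator of `D` and of its conjugate `(1 + y) D (1 - y)` is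
`1 - (y - 2 D y + D ^ 2 y)`; the identity is stated without inverses. -/
lemma mul_conj_eq_of_mul_eq_self {M : Type*} [Ring M] {D y : M} (hD : y * D = y)
    (hy : y * y = 0) :
    D * ((1 + y) * D * (1 - y)) =
      (1 - (y - (D * y + D * y) + D * (D * y))) * ((1 + y) * D * (1 - y)) * D := by
  have hD' : ∀ z, y * (D * z) = y * z := fun z ↦ by rw [← mul_assoc, hD]
  simp only [mul_add, add_mul, mul_sub, sub_mul, mul_assoc, hD, hy, hD', mul_one, one_mul, zero_mul,
    mul_zero]
  abel

variable {S : Type*} [Ring S] {S₀ : Subring S}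

local notation "𝕌" => IncidenceAlgebra S ℕ

/-- Let the nonzero entries of `x` have row index in `P` and column index outside `P`. Then `1 + x`
is the commutator of two conjugate elements of order `k`; the first one is the diagonal matrix with
entries `ω` on `P` and `1` elsewhere. -/
lemma isCommutatorOf_one_add (hS₀ : Subring.center S ≤ S₀) {k : ℕ} (hk : k ≠ 0) {ω u : S}
    (hω : ω ∈ Subring.center S) (hu : u ∈ Subring.center S) (hωk : ω ^ k = 1)
    (huω : u * (1 - ω) = 1) (P : ℕ → Prop) [DecidablePred P] (x : 𝕌)
    (hx : ∀ i j, x i j ≠ 0 → P i ∧ ¬ P j) (hx1 : ∀ i, x i (i + 1) ∈ S₀) :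
    ∃ X ∈ bandUnipotent S₀ hS₀, (X : 𝕌) = 1 + x ∧
      IsCommutatorOf (HasOrderIn (bandSubring S₀ hS₀ : Set 𝕌) k)
        (HasOrderIn (bandSubring S₀ hS₀ : Set 𝕌) k) (X : 𝕌) := by
  have hx0 : ∀ i, x i i = 0 := fun i ↦ by
    by_contra h
    exact (hx i i h).2 (hx i i h).1
  set d : ℕ → S := fun i ↦ if P i then ω else 1 with hd
  have hdk : incidenceDiagonal d ^ k = 1 := by
    rw [incidenceDiagonal_pow]
    ext i j _
    simp only [incidenceDiagonal_apply, IncidenceAlgebra.one_apply, hd]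
    split_ifs <;> simp [hωk]
  have hdmem : incidenceDiagonal d ∈ bandSubring S₀ hS₀ :=
    incidenceDiagonal_mem_bandSubring fun i ↦ by
      simp only [hd]; split_ifs
      exacts [hω, one_mem _]
  set y : 𝕌 := incidenceDiagonal (fun _ ↦ -(u * u)) * x with hy
  have hye : ∀ i j, y i j = -(u * u) * x i j := fun i j ↦ incidenceDiagonal_mul _ _ _ _
  have hyP : ∀ i j, y i j ≠ 0 → P i ∧ ¬ P j := fun i j h ↦ hx i j fun h' ↦ h (by
    rw [hye, h', mul_zero])
  have hyD : y * incidenceDiagonal d = y := by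
    ext i j _
    rw [mul_incidenceDiagonal]
    by_cases h : y i j = 0
    · rw [h, zero_mul]
    · simp [hd, (hyP i j h).2]
  have hyy : y * y = 0 := by
    ext i j _
    rw [IncidenceAlgebra.mul_apply]
    refine Finset.sum_eq_zero fun l _ ↦ ?_
    by_contra h
    exact (hyP i l (left_ne_zero_of_mul h)).2 (hyP l j (right_ne_zero_of_mul h)).1
  have hxy : 1 + x = 1 - (y - (incidenceDiagonal d * y + incidenceDiagonal d * y)
      + incidenceDiagonal d * (incidenceDiagonal d * y)) := by
    rw [sub_eq_add_neg]
    congr 1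
    ext i j _
    simp only [IncidenceAlgebra.neg_apply, IncidenceAlgebra.add_apply, IncidenceAlgebra.sub_apply,
      incidenceDiagonal_mul]
    by_cases h : x i j = 0
    · simp [hye, h]
    · have e : u * u * ((1 - ω) * (1 - ω)) = 1 := by
        rw [mul_assoc, ← mul_assoc u (1 - ω), huω, one_mul, huω]
      have e' : (1 - (ω + ω) + ω * ω) * (u * u) = 1 := by
        rw [Subring.mem_center_iff.1 (mul_mem hu hu)]
        refine Eq.trans ?_ e
        noncomm_ring
      simp only [hd, if_pos (hx i j h).1, hye]
      calc x i j = ((1 - (ω + ω) + ω * ω) * (u * u)) * x i j := by rw [e', one_mul]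
        _ = _ := by noncomm_ring
  obtain ⟨X, hX, hXx⟩ := exists_mem_bandUnipotent hS₀ (1 + x)
    (fun i ↦ by simp [IncidenceAlgebra.add_apply, hx0])
    (fun i ↦ by simpa [IncidenceAlgebra.add_apply] using hx1 i)
  have hgg : (1 + y) * (1 - y) = 1 := by rw [add_mul, mul_sub, mul_sub, hyy]; simp
  have hgg' : (1 - y) * (1 + y) = 1 := by rw [sub_mul, mul_add, mul_add, hyy]; simp
  let D : 𝕌ˣ := Units.ofPowEqOne _ k hdk hk
  let g : 𝕌ˣ := ⟨1 + y, 1 - y, hgg, hgg'⟩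
  have hymem : y ∈ bandSubring S₀ hS₀ := fun i ↦ by
    rw [hye, hye, hx0, mul_zero]
    exact ⟨zero_mem _, mul_mem (hS₀ (neg_mem (mul_mem hu hu))) (hx1 i)⟩
  have hDk : D ^ k = 1 := Units.ext hdk
  refine ⟨X, hX, hXx, D, g * D * g⁻¹, ⟨hdmem, hdk⟩, ⟨?_, ?_⟩, congrArg Units.val ?_⟩
  · exact mul_mem (mul_mem (add_mem (one_mem _) hymem) hdmem) (sub_mem (one_mem _) hymem)
  · rw [← Units.val_pow_eq_pow_val, conj_pow, hDk]
    simp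
  · have key : D * (g * D * g⁻¹) = X * (g * D * g⁻¹) * D := Units.ext (by
      have := mul_conj_eq_of_mul_eq_self hyD hyy
      rw [← hxy, ← hXx] at this
      exact this)
    rw [key]
    group

end Transvections

/-! ### Conjugation to a matrix supported on one block superdiagonal -/

section BlockShift

variable {S : Type*} [Ring S]

local notation "𝕌" => IncidenceAlgebra S ℕ

lemma incidence_mul_eq_sum (f g : 𝕌) (i j : ℕ) (T : Finset ℕ) (hT : ∀ x, x ∉ T → f i x = 0) :
    (f * g) i j = ∑ x ∈ T, f i x * g x j := by
  rw [IncidenceAlgebra.mul_apply]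
  trans ∑ x ∈ Finset.Icc i j ∪ T, f i x * g x j
  · refine Finset.sum_subset Finset.subset_union_left fun x _ hx ↦ ?_
    rw [Finset.mem_Icc, not_and_or] at hx
    rcases hx with hx | hx
    · rw [IncidenceAlgebra.apply_eq_zero_of_not_le hx, zero_mul]
    · rw [IncidenceAlgebra.apply_eq_zero_of_not_le hx, mul_zero]
  · exact (Finset.sum_subset Finset.subset_union_right fun x _ hx ↦ by
      rw [hT x hx, zero_mul]).symm

/-- The matrix whose only nonzero `2 × 2` blocks are the blocks
`!![1, n q; o q, 1 + o q * n q]` with rows `2 q, 2 q + 1` and columns `2 q + 2, 2 q + 3`. -/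
def blockShift (o n : ℕ → S) : 𝕌 :=
  ⟨fun i j ↦ if j / 2 = i / 2 + 1 then
      if i % 2 = 0 then (if j % 2 = 0 then 1 else n (i / 2))
      else (if j % 2 = 0 then o (i / 2) else 1 + o (i / 2) * n (i / 2))
    else 0, fun i j h ↦ if_neg (by omega)⟩

lemma blockShift_apply (o n : ℕ → S) (i j : ℕ) :
    blockShift o n i j = if j / 2 = i / 2 + 1 then
      if i % 2 = 0 then (if j % 2 = 0 then 1 else n (i / 2))
      else (if j % 2 = 0 then o (i / 2) else 1 + o (i / 2) * n (i / 2))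
    else 0 := rfl

lemma blockShift_mul_even (o n : ℕ → S) (f : 𝕌) (q j : ℕ) :
    (blockShift o n * f) (2 * q) j = f (2 * q + 2) j + n q * f (2 * q + 3) j := by
  rw [incidence_mul_eq_sum _ _ _ _ {2 * q + 2, 2 * q + 3}, Finset.sum_pair (by omega)]
  · rw [blockShift_apply, blockShift_apply, if_pos (by omega), if_pos (by omega),
      if_pos (by omega), if_pos (by omega), if_pos (by omega), if_neg (by omega), one_mul,
      show 2 * q / 2 = q by omega]
  · intro x hx
    simp only [Finset.mem_insert, Finset.mem_singleton, not_or] at hx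
    rw [blockShift_apply, if_neg (by omega)]

lemma blockShift_mul_odd (o n : ℕ → S) (f : 𝕌) (q j : ℕ) :
    (blockShift o n * f) (2 * q + 1) j =
      o q * f (2 * q + 2) j + (1 + o q * n q) * f (2 * q + 3) j := by
  rw [incidence_mul_eq_sum _ _ _ _ {2 * q + 2, 2 * q + 3}, Finset.sum_pair (by omega)]
  · rw [blockShift_apply, blockShift_apply, if_pos (by omega), if_neg (by omega),
      if_pos (by omega), if_pos (by omega), if_neg (by omega), if_neg (by omega),
      show (2 * q + 1) / 2 = q by omega]
  · intro x hx
    simp only [Finset.mem_insert, Finset.mem_singleton, not_or] at hx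
    rw [blockShift_apply, if_neg (by omega)]

/-- The product of the row vector `v` with the upper triangular matrix `M`. -/
def rowMul (v : ℕ → S) (M : 𝕌) (j : ℕ) : S := ∑ x ∈ Finset.range (j + 1), v x * M x j

lemma rowMul_eq_zero {v : ℕ → S} {M : 𝕌} {j : ℕ} (hv : ∀ i < j, v i = 0) (hM : M j j = 0) :
    rowMul v M j = 0 :=
  Finset.sum_eq_zero fun x hx ↦ by
    rcases (Nat.lt_succ_iff.1 (Finset.mem_range.1 hx)).eq_or_lt with rfl | h
    · rw [hM, mul_zero]
    · rw [hv x h, zero_mul]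

lemma rowMul_add {v : ℕ → S} (M : 𝕌) {a : ℕ} (hv : ∀ i < a, v i = 0) (d : ℕ) :
    rowMul v M (a + d) = ∑ x ∈ Finset.range (d + 1), v (a + x) * M (a + x) (a + d) := by
  rw [rowMul, add_assoc, Finset.sum_range_add, Finset.sum_eq_zero, zero_add]
  intro x hx
  rw [hv x (Finset.mem_range.1 hx), zero_mul]

lemma incidence_mul_eq_rowMul {f : 𝕌} {v : ℕ → S} (M : 𝕌) {i j : ℕ}
    (hf : ∀ x, f i x = v x) : (f * M) i j = rowMul v M j := by
  rw [rowMul, IncidenceAlgebra.mul_apply]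
  simp only [hf]
  refine Finset.sum_subset (fun x hx ↦ ?_) fun x hx hx' ↦ ?_
  · rw [Finset.mem_Icc] at hx
    exact Finset.mem_range.2 (by omega)
  · rw [Finset.mem_range] at hx
    rw [Finset.mem_Icc] at hx'
    rw [← hf, IncidenceAlgebra.apply_eq_zero_of_not_le (by omega), zero_mul]

/-- A matrix `M` with suitable entries near the diagonal is conjugate to the block shift `K` whose
blocks `B q = !![1, n q; o q, 1 + o q * n q]` are those of `M` at the same places. The block has the
inverse `!![1 + n q * o q, -n q; -o q, 1]`, so that `P * M = K * P` determines the rows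
`v (q + 1), w (q + 1)` of `P` of index `2 q + 2, 2 q + 3` from the rows `v q, w q` of index
`2 q, 2 q + 1`: they are `(B q)⁻¹` times `v q * M, w q * M`. The first two rows are taken from the
identity matrix.

The sequences `α`, `β`, `γ` are the entries of `P` at `(2 q, 2 q + 2)`, `(2 q, 2 q + 3)` and
`(2 q + 1, 2 q + 3)`. The hypothesis `hc` says that the recursion produces the value `0` for the
entry of `P` at `(2 q + 3, 2 q + 4)`. As `P` vanishes on the first superdiagonal, it lies in
`bandUnipotent` for every choice of `S₀`. -/
theorem exists_conj_blockShift (M : 𝕌) (o n α β γ : ℕ → S) (hM : ∀ i, M i i = 0)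
    (h01 : ∀ q, M (2 * q) (2 * q + 1) = 0) (h12 : ∀ q, M (2 * q + 1) (2 * q + 2) = o q)
    (h02 : ∀ q, M (2 * q) (2 * q + 2) = 1) (h03 : ∀ q, M (2 * q) (2 * q + 3) = n q)
    (h13 : ∀ q, M (2 * q + 1) (2 * q + 3) = 1 + o q * n q)
    (hα0 : α 0 = 0) (hβ0 : β 0 = 0) (hγ0 : γ 0 = 0)
    (hα : ∀ q, α (q + 1) = M (2 * q) (2 * q + 4) + α q + β q * o (q + 1))
    (hβ : ∀ q, β (q + 1) =
      (1 + n q * o q) *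
        (M (2 * q) (2 * q + 5) + α q * n (q + 1) + β q * (1 + o (q + 1) * n (q + 1)))
      - n q * (M (2 * q + 1) (2 * q + 5) + γ q * (1 + o (q + 1) * n (q + 1))))
    (hγ : ∀ q, γ (q + 1) =
      M (2 * q + 1) (2 * q + 5) + γ q * (1 + o (q + 1) * n (q + 1))
      - o q * (M (2 * q) (2 * q + 5) + α q * n (q + 1) + β q * (1 + o (q + 1) * n (q + 1))))
    (hc : ∀ q, M (2 * q + 1) (2 * q + 4) + γ q * o (q + 1) =
      o q * (M (2 * q) (2 * q + 4) + α q + β q * o (q + 1))) :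
    ∃ P : 𝕌, (∀ i, P i i = 1) ∧ (∀ i, P i (i + 1) = 0) ∧ P * M = blockShift o n * P := by
  let r : ℕ → (ℕ → S) × (ℕ → S) := fun q ↦ Nat.rec
    (fun j ↦ if j = 0 then 1 else 0, fun j ↦ if j = 1 then 1 else 0)
    (fun q vw ↦
      (fun j ↦ (1 + n q * o q) * rowMul vw.1 M j - n q * rowMul vw.2 M j,
        fun j ↦ rowMul vw.2 M j - o q * rowMul vw.1 M j)) q
  set v : ℕ → ℕ → S := fun q ↦ (r q).1 with hv
  set w : ℕ → ℕ → S := fun q ↦ (r q).2 with hw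
  have hv0 : ∀ j, v 0 j = if j = 0 then 1 else 0 := fun j ↦ rfl
  have hw0 : ∀ j, w 0 j = if j = 1 then 1 else 0 := fun j ↦ rfl
  have hvs : ∀ q j, v (q + 1) j = (1 + n q * o q) * rowMul (v q) M j - n q * rowMul (w q) M j :=
    fun q j ↦ rfl
  have hws : ∀ q j, w (q + 1) j = rowMul (w q) M j - o q * rowMul (v q) M j := fun q j ↦ rfl
  clear_value v w
  clear hv hw r
  have key : ∀ q, ((∀ j < 2 * q, v q j = 0) ∧ v q (2 * q) = 1 ∧ v q (2 * q + 1) = 0 ∧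
      v q (2 * q + 2) = α q ∧ v q (2 * q + 3) = β q) ∧
      ((∀ j < 2 * q + 1, w q j = 0) ∧ w q (2 * q + 1) = 1 ∧ w q (2 * q + 2) = 0 ∧
      w q (2 * q + 3) = γ q) := by
    intro q
    induction q with
    | zero => simp [hv0, hw0, hα0, hβ0, hγ0]
    | succ q ih =>
      obtain ⟨⟨v0, v1, v2, v3, v4⟩, w0, w1, w2, w3⟩ := ih
      have e1 : ∀ i, M (2 * q + 2 + i) (2 * q + 2 + i) = 0 := fun i ↦ hM _
      have e2 : M (2 * q + 2) (2 * q + 3) = 0 := h01 (q + 1)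
      have e3 : M (2 * q + 3) (2 * q + 4) = o (q + 1) := h12 (q + 1)
      have e4 : M (2 * q + 2) (2 * q + 4) = 1 := h02 (q + 1)
      have e5 : M (2 * q + 2) (2 * q + 5) = n (q + 1) := h03 (q + 1)
      have e6 : M (2 * q + 3) (2 * q + 5) = 1 + o (q + 1) * n (q + 1) := h13 (q + 1)
      have e7 : M (2 * q + 4) (2 * q + 5) = 0 := h01 (q + 2)
      have w0' : ∀ j < 2 * q, w q j = 0 := fun j hj ↦ w0 j (by omega)
      have w00 : w q (2 * q) = 0 := w0 _ (by omega)
      -- the rows `v q * M` and `w q * M` near their leading entries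
      have V2 : rowMul (v q) M (2 * q + 2) = 1 := by
        rw [rowMul_add M v0]
        simp [Finset.sum_range_succ, v1, v2, hM, h02]
      have V3 : rowMul (v q) M (2 * q + 3) = n q := by
        rw [rowMul_add M v0]
        simp [Finset.sum_range_succ, v1, v2, hM, h03, e2]
      have V4 : rowMul (v q) M (2 * q + 4) = M (2 * q) (2 * q + 4) + α q + β q * o (q + 1) := by
        rw [rowMul_add M v0]
        simp [Finset.sum_range_succ, v1, v2, v3, v4, hM, e3, e4]
      have V5 : rowMul (v q) M (2 * q + 5) = M (2 * q) (2 * q + 5) + α q * n (q + 1)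
          + β q * (1 + o (q + 1) * n (q + 1)) := by
        rw [rowMul_add M v0]
        simp [Finset.sum_range_succ, v1, v2, v3, v4, hM, e5, e6, e7]
      have W2 : rowMul (w q) M (2 * q + 2) = o q := by
        rw [rowMul_add M w0']
        simp [Finset.sum_range_succ, w00, w1, hM, h12]
      have W3 : rowMul (w q) M (2 * q + 3) = 1 + o q * n q := by
        rw [rowMul_add M w0']
        simp [Finset.sum_range_succ, w00, w1, hM, h13, e2]
      have W4 : rowMul (w q) M (2 * q + 4) = M (2 * q + 1) (2 * q + 4) + γ q * o (q + 1) := by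
        rw [rowMul_add M w0']
        simp [Finset.sum_range_succ, w00, w1, w2, w3, hM, e3]
      have W5 : rowMul (w q) M (2 * q + 5) = M (2 * q + 1) (2 * q + 5)
          + γ q * (1 + o (q + 1) * n (q + 1)) := by
        rw [rowMul_add M w0']
        simp [Finset.sum_range_succ, w00, w1, w2, w3, hM, e6, e7]
      have Vz : ∀ j < 2 * q + 2, rowMul (v q) M j = 0 := by
        intro j hj
        rcases Nat.lt_or_ge j (2 * q + 1) with h | h
        · exact rowMul_eq_zero (fun i hi ↦ v0 i (by omega)) (hM j)
        · obtain rfl : j = 2 * q + 1 := by omega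
          rw [rowMul_add M v0]
          simp [Finset.sum_range_succ, v2, h01]
      have Wz : ∀ j < 2 * q + 2, rowMul (w q) M j = 0 := fun j hj ↦
        rowMul_eq_zero (fun i hi ↦ w0 i (by omega)) (hM j)
      rw [show 2 * (q + 1) = 2 * q + 2 by ring]
      refine ⟨⟨fun j hj ↦ ?_, ?_, ?_, ?_, ?_⟩, fun j hj ↦ ?_, ?_, ?_, ?_⟩
      · rw [hvs, Vz j hj, Wz j hj]; simp
      · rw [hvs, V2, W2]; noncomm_ring
      · rw [hvs, V3, W3]; noncomm_ring
      · rw [hvs, V4, W4, hc, hα]; noncomm_ring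
      · rw [hvs, V5, W5, hβ]
      · rw [hws]
        rcases Nat.lt_or_ge j (2 * q + 2) with h | h
        · rw [Vz j h, Wz j h]; simp
        · obtain rfl : j = 2 * q + 2 := by omega
          rw [V2, W2]; simp
      · rw [hws, V3, W3]; simp
      · rw [hws, V4, W4, hc]; simp
      · rw [hws, V5, W5, hγ]
  set P : 𝕌 := incidenceOfFun fun i j ↦ if i % 2 = 0 then v (i / 2) j else w (i / 2) j with hP
  have hPv : ∀ q j, P (2 * q) j = v q j := fun q j ↦ by
    by_cases h : 2 * q ≤ j
    · rw [hP, incidenceOfFun_apply _ h, if_pos (by omega), show 2 * q / 2 = q by omega]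
    · rw [IncidenceAlgebra.apply_eq_zero_of_not_le h, (key q).1.1 j (by omega)]
  have hPw : ∀ q j, P (2 * q + 1) j = w q j := fun q j ↦ by
    by_cases h : 2 * q + 1 ≤ j
    · rw [hP, incidenceOfFun_apply _ h, if_neg (by omega), show (2 * q + 1) / 2 = q by omega]
    · rw [IncidenceAlgebra.apply_eq_zero_of_not_le h, (key q).2.1 j (by omega)]
  have hPv' : ∀ q j, P (2 * q + 2) j = v (q + 1) j := fun q j ↦ hPv (q + 1) j
  have hPw' : ∀ q j, P (2 * q + 3) j = w (q + 1) j := fun q j ↦ hPw (q + 1) j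
  refine ⟨P, fun i ↦ ?_, fun i ↦ ?_, ?_⟩
  · obtain ⟨q, rfl | rfl⟩ := Nat.even_or_odd' i
    · rw [hPv, (key q).1.2.1]
    · rw [hPw, (key q).2.2.1]
  · obtain ⟨q, rfl | rfl⟩ := Nat.even_or_odd' i
    · rw [hPv, (key q).1.2.2.1]
    · rw [hPw, (key q).2.2.2.1]
  · ext i j hij
    obtain ⟨q, rfl | rfl⟩ := Nat.even_or_odd' i
    · rw [incidence_mul_eq_rowMul M (hPv q), blockShift_mul_even, hPv', hPw', hvs, hws]
      noncomm_ring
    · rw [incidence_mul_eq_rowMul M (hPw q), blockShift_mul_odd, hPv', hPw', hvs, hws]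
      noncomm_ring

end BlockShift

/-! ### Six commutators of elements of order `k` -/

section SixCommutators

lemma IsCommutatorOf.inv {M : Type*} [Ring M] {Q : M → Prop} {x : Mˣ}
    (h : IsCommutatorOf Q Q (x : M)) : IsCommutatorOf Q Q ((x⁻¹ : Mˣ) : M) := by
  obtain ⟨B, C, hB, hC, hx⟩ := h
  refine ⟨C, B, hC, hB, congrArg Units.val ?_⟩
  rw [Units.ext hx]
  group

variable {S : Type*} [Ring S] {S₀ : Subring S} {hS₀ : Subring.center S ≤ S₀}

local notation "𝕌" => IncidenceAlgebra S ℕ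

lemma incidence_apply_add_ne (i d : ℕ) (hd : d ≠ 0) : (1 : 𝕌) i (i + d) = 0 := by
  rw [IncidenceAlgebra.one_apply, if_neg (by omega)]

/-- The unipotent matrices with second superdiagonal equal to `1` and with zeros on the first and third
superdiagonals are conjugate to each other. -/
lemma exists_conj_one_add_blockShift_zero {X : 𝕌ˣ} (hX : ∀ i, (X : 𝕌) i i = 1)
    (h1 : ∀ i, (X : 𝕌) i (i + 1) = 0) (h2 : ∀ i, (X : 𝕌) i (i + 2) = 1)
    (h3 : ∀ i, (X : 𝕌) i (i + 3) = 0) :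
    ∃ P ∈ bandUnipotent S₀ hS₀, ((P * X * P⁻¹ : 𝕌ˣ) : 𝕌) = 1 + blockShift 0 0 := by
  set M : 𝕌 := X - 1 with hM
  have hMa : ∀ i d, d ≠ 0 → M i (i + d) = (X : 𝕌) i (i + d) := fun i d hd ↦ by
    rw [hM, IncidenceAlgebra.sub_apply, incidence_apply_add_ne i d hd, sub_zero]
  obtain ⟨P, hP, hP1, hPM⟩ := exists_conj_blockShift M 0 0
    (fun q ↦ ∑ i ∈ Finset.range q, M (2 * i) (2 * i + 4))
    (fun q ↦ ∑ i ∈ Finset.range q, M (2 * i) (2 * i + 5))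
    (fun q ↦ ∑ i ∈ Finset.range q, M (2 * i + 1) (2 * i + 5))
    (fun i ↦ by simp [hM, IncidenceAlgebra.sub_apply, hX])
    (fun q ↦ (hMa _ 1 one_ne_zero).trans (h1 _))
    (fun q ↦ (hMa _ 1 one_ne_zero).trans (h1 _))
    (fun q ↦ (hMa _ 2 two_ne_zero).trans (h2 _))
    (fun q ↦ (hMa _ 3 three_ne_zero).trans (h3 _))
    (fun q ↦ ((hMa (2 * q + 1) 2 two_ne_zero).trans (h2 _)).trans (by simp))
    rfl rfl rfl (fun q ↦ by simp [Finset.sum_range_succ, add_comm])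
    (fun q ↦ by simp [Finset.sum_range_succ, add_comm])
    (fun q ↦ by simp [Finset.sum_range_succ, add_comm])
    (fun q ↦ by
      have : M (2 * q + 1) (2 * q + 4) = 0 := (hMa (2 * q + 1) 3 three_ne_zero).trans (h3 _)
      simp [this])
  obtain ⟨p, hp, rfl⟩ := exists_mem_bandUnipotent hS₀ P hP (fun i ↦ by rw [hP1]; exact zero_mem _)
  refine ⟨p, hp, ?_⟩
  rw [Units.val_mul, Units.mul_inv_eq_iff_eq_mul, Units.val_mul, add_mul, ← hPM, hM, mul_sub]
  simp

/-- The matrix with entry `c i` at `(i, i + 2)` for the rows `i` satisfying `p`, and zeros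
elsewhere. -/
def secondSuperdiagonal (p : ℕ → Prop) [DecidablePred p] (c : ℕ → S) : 𝕌 :=
  incidenceOfFun fun i j ↦ if p i ∧ j = i + 2 then c i else 0

lemma secondSuperdiagonal_apply (p : ℕ → Prop) [DecidablePred p] (c : ℕ → S) (i j : ℕ) :
    secondSuperdiagonal p c i j = if p i ∧ j = i + 2 then c i else 0 := by
  by_cases h : i ≤ j
  · exact incidenceOfFun_apply _ h
  · rw [IncidenceAlgebra.apply_eq_zero_of_not_le h, if_neg (by omega)]

/-- The matrix with entries `a i` at `(i, i + 1)` and `b i` at `(i, i + 3)` for the rows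
`i ≡ e (mod 2)`, and zeros elsewhere. -/
def parityBand (e : ℕ) (a b : ℕ → S) : 𝕌 :=
  incidenceOfFun fun i j ↦ if i % 2 = e then
    (if j = i + 1 then a i else if j = i + 3 then b i else 0) else 0

lemma parityBand_apply (e : ℕ) (a b : ℕ → S) (i j : ℕ) :
    parityBand e a b i j = if i % 2 = e then
      (if j = i + 1 then a i else if j = i + 3 then b i else 0) else 0 := by
  by_cases h : i ≤ j
  · exact incidenceOfFun_apply _ h
  · rw [IncidenceAlgebra.apply_eq_zero_of_not_le h, if_neg (by omega : ¬ j = i + 1),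
      if_neg (by omega : ¬ j = i + 3), ite_self]

/-- If `ω ^ k = 1` and `1 - ω` is invertible, every `A` in `bandUnipotent` is a product of six
commutators of elements of order `k`. Two commutators remove the first and third superdiagonals of
`A`, and two more replace the second superdiagonal by ones. The result is conjugate to a product of
two commutators, because both are conjugate to `1 + blockShift 0 0`. -/
theorem isProdOfCommutators_six (hS₀ : Subring.center S ≤ S₀) {k : ℕ} (hk : k ≠ 0) {ω u : S}
    (hω : ω ∈ Subring.center S) (hu : u ∈ Subring.center S) (hωk : ω ^ k = 1)
    (huω : u * (1 - ω) = 1) {A : 𝕌ˣ} (hA : A ∈ bandUnipotent S₀ hS₀) :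
    IsProdOfCommutators 6 (HasOrderIn (bandSubring S₀ hS₀ : Set 𝕌) k)
      (HasOrderIn (bandSubring S₀ hS₀ : Set 𝕌) k) (A : 𝕌) := by
  -- right multiplication by `Y` kills the entries of `A` at `(i, i + 1)` and `(i, i + 3)`, `i` even
  obtain ⟨Y, hY, hYx, hYc⟩ := isCommutatorOf_one_add hS₀ hk hω hu hωk huω (fun i ↦ i % 2 = 0)
    (parityBand 0 (fun i ↦ -(A : 𝕌) i (i + 1))
      (fun i ↦ (A : 𝕌) i (i + 2) * (A : 𝕌) (i + 2) (i + 3) - (A : 𝕌) i (i + 3)))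
    (fun i j h ↦ by
      rw [parityBand_apply] at h
      split_ifs at h <;> first | omega | simp at h)
    (fun i ↦ by
      rw [parityBand_apply]
      split_ifs
      exacts [neg_mem (hA.2 i).2, by omega, by omega, zero_mem _])
  have hYe : ∀ i d, (Y : 𝕌) i (i + d) = (1 : 𝕌) i (i + d) + _ := fun i d ↦ by
    rw [hYx, IncidenceAlgebra.add_apply]
  have hAY : A * Y ∈ bandUnipotent S₀ hS₀ := mul_mem hA hY
  set A₁ := A * Y with hA₁
  have hA₁1 : ∀ i, i % 2 = 0 → (A₁ : 𝕌) i (i + 1) = 0 := fun i hi ↦ by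
    rw [hA₁, Units.val_mul, incidence_mul_one, hA.1, hY.1, hYe]
    simp [parityBand_apply, hi]
  have hA₁3 : ∀ i, i % 2 = 0 → (A₁ : 𝕌) i (i + 3) = 0 := fun i hi ↦ by
    have e1 : (Y : 𝕌) (i + 1) (i + 3) = 0 := by
      rw [hYe (i + 1) 2]
      simp [parityBand_apply]
    have e2 : (Y : 𝕌) (i + 2) (i + 3) = -(A : 𝕌) (i + 2) (i + 3) := by
      rw [hYe (i + 2) 1]
      simp [parityBand_apply, hi]
    rw [hA₁, Units.val_mul, incidence_mul_three, hA.1, hY.1, e1, e2, hYe]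
    simp [parityBand_apply, hi]
    abel
  -- left multiplication by `Z` kills the entries at `(i, i + 1)` and `(i, i + 3)`, `i` odd
  obtain ⟨Z, hZ, hZx, hZc⟩ := isCommutatorOf_one_add hS₀ hk hω hu hωk huω (fun i ↦ i % 2 = 1)
    (parityBand 1 (fun i ↦ -(A₁ : 𝕌) i (i + 1))
      (fun i ↦ (A₁ : 𝕌) i (i + 1) * (A₁ : 𝕌) (i + 1) (i + 3) - (A₁ : 𝕌) i (i + 3)))
    (fun i j h ↦ by
      rw [parityBand_apply] at h
      split_ifs at h <;> first | omega | simp at h)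
    (fun i ↦ by
      rw [parityBand_apply]
      split_ifs
      exacts [neg_mem (hAY.2 i).2, by omega, by omega, zero_mem _])
  have hZe : ∀ i d, (Z : 𝕌) i (i + d) = (1 : 𝕌) i (i + d) + _ := fun i d ↦ by
    rw [hZx, IncidenceAlgebra.add_apply]
  have hZA : Z * A₁ ∈ bandUnipotent S₀ hS₀ := mul_mem hZ hAY
  set A₂ := Z * A₁ with hA₂
  have hA₂1 : ∀ i, (A₂ : 𝕌) i (i + 1) = 0 := fun i ↦ by
    rw [hA₂, Units.val_mul, incidence_mul_one, hAY.1, hZ.1, hZe]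
    rcases Nat.mod_two_eq_zero_or_one i with hi | hi
    · simp [parityBand_apply, hi, hA₁1]
    · simp [parityBand_apply, hi]
  have hA₂3 : ∀ i, (A₂ : 𝕌) i (i + 3) = 0 := fun i ↦ by
    rw [hA₂, Units.val_mul, incidence_mul_three, hAY.1, hZ.1, hZe, hZe, hZe]
    rcases Nat.mod_two_eq_zero_or_one i with hi | hi
    · simp [parityBand_apply, hi, hA₁3]
    · simp [parityBand_apply, hi]
      abel
  -- a product of two commutators with a given second superdiagonal
  have hpair : ∀ c : ℕ → S, ∃ X ∈ bandUnipotent S₀ hS₀, ∃ X' ∈ bandUnipotent S₀ hS₀,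
      (IsCommutatorOf (HasOrderIn (bandSubring S₀ hS₀ : Set 𝕌) k)
        (HasOrderIn (bandSubring S₀ hS₀ : Set 𝕌) k) (X : 𝕌) ∧
      IsCommutatorOf (HasOrderIn (bandSubring S₀ hS₀ : Set 𝕌) k)
        (HasOrderIn (bandSubring S₀ hS₀ : Set 𝕌) k) (X' : 𝕌)) ∧
      ∀ i, ((X * X' : 𝕌ˣ) : 𝕌) i (i + 1) = 0 ∧ ((X * X' : 𝕌ˣ) : 𝕌) i (i + 2) = c i ∧
        ((X * X' : 𝕌ˣ) : 𝕌) i (i + 3) = 0 := fun c ↦ by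
    obtain ⟨X, hX, hXx, hXc⟩ := isCommutatorOf_one_add hS₀ hk hω hu hωk huω (fun i ↦ i % 4 < 2)
      (secondSuperdiagonal (fun i ↦ i % 4 < 2) c)
      (fun i j h ↦ by
        rw [secondSuperdiagonal_apply] at h
        split_ifs at h <;> first | omega | simp at h)
      (fun i ↦ by simp [secondSuperdiagonal_apply, zero_mem])
    obtain ⟨X', hX', hXx', hXc'⟩ := isCommutatorOf_one_add hS₀ hk hω hu hωk huω
      (fun i ↦ ¬ i % 4 < 2) (secondSuperdiagonal (fun i ↦ ¬ i % 4 < 2) c)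
      (fun i j h ↦ by
        rw [secondSuperdiagonal_apply] at h
        split_ifs at h <;> first | omega | simp at h)
      (fun i ↦ by simp [secondSuperdiagonal_apply, zero_mem])
    refine ⟨X, hX, X', hX', ⟨hXc, hXc'⟩, fun i ↦ ⟨?_, ?_, ?_⟩⟩
    · rw [Units.val_mul, incidence_mul_one, hX.1, hX'.1, hXx, hXx']
      simp [IncidenceAlgebra.add_apply, secondSuperdiagonal_apply]
    · rw [Units.val_mul, incidence_mul_two, hX.1, hX'.1, hXx, hXx']
      simp only [IncidenceAlgebra.add_apply, secondSuperdiagonal_apply,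
        incidence_apply_add_ne i 2 two_ne_zero]
      by_cases hi : i % 4 < 2 <;> simp [hi]
    · rw [Units.val_mul, incidence_mul_three, hX.1, hX'.1, hXx, hXx']
      simp [IncidenceAlgebra.add_apply, secondSuperdiagonal_apply]
  obtain ⟨X, hX, X', hX', ⟨hXc, hXc'⟩, hXX⟩ := hpair fun i ↦ 1 - (A₂ : 𝕌) i (i + 2)
  obtain ⟨V, hV, V', hV', ⟨hVc, hVc'⟩, hVV⟩ := hpair fun _ ↦ 1
  have hXXm := mul_mem hX hX'
  have hVVm := mul_mem hV hV'
  have hA₃m := mul_mem hZA hXXm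
  obtain ⟨P, hP, hPX⟩ := exists_conj_one_add_blockShift_zero (S₀ := S₀) (hS₀ := hS₀)
    (X := A₂ * (X * X')) hA₃m.1
    (fun i ↦ by
      rw [Units.val_mul, incidence_mul_one, (hXX i).1, hA₂1]; simp)
    (fun i ↦ by
      rw [Units.val_mul, incidence_mul_two, (hXX i).2.1, hA₂1, hXXm.1, hZA.1]; simp)
    (fun i ↦ by
      have := (hXX (i + 2)).1
      rw [Units.val_mul, incidence_mul_three, (hXX i).2.2, hA₂1, this, hA₂3]; simp)
  obtain ⟨Q, hQ, hQV⟩ := exists_conj_one_add_blockShift_zero (S₀ := S₀) (hS₀ := hS₀)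
    (X := V * V') hVVm.1 (fun i ↦ (hVV i).1) (fun i ↦ (hVV i).2.1) (fun i ↦ (hVV i).2.2)
  have hconj : P * (A₂ * (X * X')) * P⁻¹ = Q * (V * V') * Q⁻¹ := Units.ext (hPX.trans hQV.symm)
  have hg := mul_mem (inv_mem hP) hQ
  set g := P⁻¹ * Q with hgdef
  have hprod : A = Z⁻¹ * (g * V * g⁻¹) * (g * V' * g⁻¹) * X'⁻¹ * X⁻¹ * Y⁻¹ := by
    have h1 : A₂ * (X * X') = g * (V * V') * g⁻¹ := by
      calc A₂ * (X * X') = P⁻¹ * (P * (A₂ * (X * X')) * P⁻¹) * P := by group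
        _ = g * (V * V') * g⁻¹ := by rw [hconj, hgdef]; group
    calc A = Z⁻¹ * (A₂ * (X * X')) * X'⁻¹ * X⁻¹ * Y⁻¹ := by rw [hA₂, hA₁]; group
      _ = _ := by rw [h1]; group
  have hconjc : ∀ x : 𝕌ˣ, IsCommutatorOf (HasOrderIn (bandSubring S₀ hS₀ : Set 𝕌) k)
        (HasOrderIn (bandSubring S₀ hS₀ : Set 𝕌) k) (x : 𝕌) → _ := fun x hx ↦
    hx.conj (bandSubring S₀ hS₀) hg.2 (inv_mem hg).2
  refine ⟨[↑Z⁻¹, ↑(g * V * g⁻¹), ↑(g * V' * g⁻¹), ↑X'⁻¹, ↑X⁻¹, ↑Y⁻¹], le_rfl, ?_, ?_⟩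
  · simp only [List.forall_mem_cons, List.not_mem_nil, false_imp_iff, implies_true, and_true]
    exact ⟨hZc.inv, hconjc V hVc, hconjc V' hVc', hXc'.inv, hXc.inv, hYc.inv⟩
  · rw [hprod]
    simp [mul_assoc]

end SixCommutators

/-! ### Two commutators of involutions -/

section TwoCommutators

variable {S : Type*} [Ring S] {S₀ : Subring S}

local notation "𝕌" => IncidenceAlgebra S ℕ

/-- The Cayley transform `(1 + h) (1 - h)⁻¹` of a matrix `h` that anticommutes with a diagonal
matrix `σ` of signs is inverted by `σ`. -/
lemma exists_cayley_inverted (hS₀ : Subring.center S ≤ S₀) {s : ℕ → S} {σ : 𝕌ˣ}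
    (hσ : (σ : 𝕌) = incidenceDiagonal s) (hσ2 : σ * σ = 1) (h : 𝕌) (h0 : ∀ i, h i i = 0)
    (h1 : ∀ i, h i (i + 1) ∈ S₀) (hs : ∀ i j, s i * h i j * s j = -h i j) :
    ∃ Z ∈ bandUnipotent S₀ hS₀, (Z : 𝕌) * (1 - h) = 1 + h ∧ σ * Z * σ = Z⁻¹ ∧
      ∀ X : 𝕌, (1 - h) * X = 1 + h → X = Z := by
  obtain ⟨a, ha, hah⟩ := exists_mem_bandUnipotent hS₀ (1 + h)
    (fun i ↦ by simp [IncidenceAlgebra.add_apply, h0])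
    (fun i ↦ by simpa [IncidenceAlgebra.add_apply] using h1 i)
  obtain ⟨b, hb, hbh⟩ := exists_mem_bandUnipotent hS₀ (1 - h)
    (fun i ↦ by simp [IncidenceAlgebra.sub_apply, h0])
    (fun i ↦ by simpa [IncidenceAlgebra.sub_apply] using h1 i)
  have hab : a * b = b * a := Units.ext (by
    rw [Units.val_mul, Units.val_mul, hah, hbh]
    simp only [mul_add, add_mul, mul_sub, sub_mul, mul_one, one_mul]
    abel)
  have hσh : (σ : 𝕌) * h * σ = -h := by
    ext i j _
    rw [hσ, mul_incidenceDiagonal, incidenceDiagonal_mul, hs, IncidenceAlgebra.neg_apply]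
  have hσσ : (σ : 𝕌) * σ = 1 := by rw [← Units.val_mul, hσ2, Units.val_one]
  have hσa : σ * a * σ = b := Units.ext (by
    rw [Units.val_mul, Units.val_mul, hah, hbh, mul_add, add_mul, hσh, mul_one, hσσ,
      sub_eq_add_neg])
  have hσb : σ * b * σ = a := by
    calc σ * b * σ = (σ * σ) * a * (σ * σ) := by rw [← hσa]; group
      _ = a := by rw [hσ2]; group
  have hba : a * b⁻¹ = b⁻¹ * a := by
    calc a * b⁻¹ = b⁻¹ * (b * a) * b⁻¹ := by group
      _ = b⁻¹ * a := by rw [← hab]; group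
  have hinv : σ⁻¹ = σ := inv_eq_of_mul_eq_one_right hσ2
  refine ⟨a * b⁻¹, mul_mem ha (inv_mem hb), ?_, ?_, fun X hX ↦ ?_⟩
  · rw [← hah, ← hbh, ← Units.val_mul]
    exact congrArg Units.val (by group)
  · calc σ * (a * b⁻¹) * σ = (σ * a * σ⁻¹) * (σ⁻¹ * b * σ⁻¹)⁻¹ := by group
      _ = (a * b⁻¹)⁻¹ := by rw [hinv, hσa, hσb]; group
  · rw [← hah, ← hbh] at hX
    rw [hba, Units.val_mul, ← hX, Units.inv_mul_cancel_left]

lemma exists_sign_unit (hS₀ : Subring.center S ≤ S₀) (p : ℕ → Prop) [DecidablePred p] :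
    ∃ σ : 𝕌ˣ, (σ : 𝕌) = incidenceDiagonal (fun i ↦ if p i then 1 else -1) ∧ σ * σ = 1 ∧
      (σ : 𝕌) ∈ bandSubring S₀ hS₀ := by
  have h : incidenceDiagonal (fun i ↦ if p i then (1 : S) else -1) ^ 2 = 1 := by
    rw [incidenceDiagonal_pow]
    ext i j _
    simp only [incidenceDiagonal_apply, IncidenceAlgebra.one_apply]
    split_ifs <;> simp
  refine ⟨Units.ofPowEqOne _ 2 h two_ne_zero, rfl, Units.ext ((pow_two _).symm.trans h), ?_⟩
  exact incidenceDiagonal_mem_bandSubring fun i ↦ by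
    split_ifs
    exacts [one_mem _, neg_mem (one_mem _)]

/-- If the entries of `X - 1` near the diagonal satisfy the conditions under which its scaled Cayley
transform `M` is conjugate to a block shift, then `X` is the commutator of two involutions: it is
conjugate to the Cayley transform of half the block shift, which is inverted by the signs
`+ + - -`. -/
lemma isCommutatorOf_of_conj_blockShift (hS₀ : Subring.center S ≤ S₀) {t : S}
    (ht : t ∈ Subring.center S) (h2 : t + t = 1) {o n : ℕ → S} (ho : ∀ q, o q ∈ S₀)
    {X P : 𝕌ˣ} {M : 𝕌} (hP : P ∈ bandUnipotent S₀ hS₀)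
    (hM : M * (1 + incidenceDiagonal (fun _ ↦ t) * (X - 1)) = X - 1)
    (hPM : P * M = blockShift o n * P) :
    IsCommutatorOf (HasOrderIn (bandSubring S₀ hS₀ : Set 𝕌) 2)
      (HasOrderIn (bandSubring S₀ hS₀ : Set 𝕌) 2) (X : 𝕌) := by
  set T : 𝕌 := incidenceDiagonal fun _ ↦ t with hT
  set K : 𝕌 := blockShift o n with hK
  have hTc : ∀ f : 𝕌, T * f = f * T := fun f ↦ by
    ext i j _
    rw [hT, incidenceDiagonal_mul, mul_incidenceDiagonal, Subring.mem_center_iff.1 ht]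
  have hTT : T + T = 1 := by
    ext i j _
    rw [hT, IncidenceAlgebra.add_apply, incidenceDiagonal_apply, IncidenceAlgebra.one_apply]
    split_ifs <;> simp [h2]
  obtain ⟨σ, hσ, hσ2, hσm⟩ := exists_sign_unit hS₀ (fun i ↦ i % 4 < 2)
  obtain ⟨Z, hZ, -, hσZ, hZu⟩ := exists_cayley_inverted hS₀ hσ hσ2 (T * K)
    (fun i ↦ by rw [hT, incidenceDiagonal_mul, hK, blockShift_apply, if_neg (by omega), mul_zero])
    (fun i ↦ by
      rw [hT, incidenceDiagonal_mul, hK, blockShift_apply]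
      split_ifs
      · omega
      · omega
      · exact mul_mem (hS₀ ht) (ho _)
      · omega
      · rw [mul_zero]; exact zero_mem _)
    (fun i j ↦ by
      rw [hT, incidenceDiagonal_mul]
      by_cases hij : j / 2 = i / 2 + 1
      · by_cases hi : i % 4 < 2
        · rw [if_pos hi, if_neg (by omega)]; simp
        · rw [if_neg hi, if_pos (by omega)]; simp
      · rw [hK, blockShift_apply, if_neg hij]; simp)
  have hN : P * ((X : 𝕌) - 1) = K * P * (1 + T * ((X : 𝕌) - 1)) := by
    rw [← hPM, mul_assoc, hM]
  have hPX : P * X * P⁻¹ = Z := Units.ext (hZu _ (by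
    rw [Units.val_mul, Units.val_mul, ← mul_assoc, Units.mul_inv_eq_iff_eq_mul]
    have e : (P : 𝕌) * X = P + K * P + T * K * (P * (X - 1)) := by
      rw [show T * K * ((P : 𝕌) * (X - 1)) = K * P * (T * (X - 1)) by
        rw [hTc K, mul_assoc, ← mul_assoc T, hTc, mul_assoc, mul_assoc]]
      calc (P : 𝕌) * X = P + P * ((X : 𝕌) - 1) := by rw [mul_sub, mul_one]; abel
        _ = _ := by rw [hN, mul_add, mul_one, add_assoc]
    have e' : K * (P : 𝕌) = T * K * P + T * K * P := by
      rw [mul_assoc, ← add_mul, hTT, one_mul]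
    calc (1 - T * K) * ((P : 𝕌) * X) = P * X - T * K * (P * X) := by
          rw [sub_mul, one_mul]
      _ = P + K * P + T * K * (P * (X - 1)) - T * K * (P * X) := by rw [← e]
      _ = P + K * P - T * K * P := by rw [mul_sub, mul_one, mul_sub]; abel
      _ = (1 + T * K) * P := by rw [e', add_mul, one_mul]; abel))
  have hXZ : X = P⁻¹ * Z * P⁻¹⁻¹ := by rw [← hPX]; group
  rw [hXZ]
  exact (isCommutatorOf_of_inverted ht h2 hZ hσm hσ2 hσZ).conj _ (inv_mem hP).2
    (inv_mem (inv_mem hP)).2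

/-- If `2` is invertible, every `A` in `bandUnipotent` is a product of two commutators of involutions.
The factorization is `A = X (Z⁻¹ Y⁻¹)`, where `Y` and `Z` are Cayley transforms inverted by the signs
`+ - - +`. The factor `Y` removes every other entry of the first superdiagonal of `A`. The factor `Z`
adjusts the second superdiagonal and every other entry of the third one, which makes `X = A Y Z`
satisfy the hypotheses of `exists_conj_blockShift`; its entries at `(2 q + 1, 2 q + 4)` are chosen
last, since they have to agree with the sequences `α`, `β`, `γ` of that lemma, on which they have no
influence. -/
theorem isProdOfCommutators_two (hS₀ : Subring.center S ≤ S₀) {t : S}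
    (ht : t ∈ Subring.center S) (h2 : t + t = 1) {A : 𝕌ˣ} (hA : A ∈ bandUnipotent S₀ hS₀) :
    IsProdOfCommutators 2 (HasOrderIn (bandSubring S₀ hS₀ : Set 𝕌) 2)
      (HasOrderIn (bandSubring S₀ hS₀ : Set 𝕌) 2) (A : 𝕌) := by
  have h2' : ∀ z, t * z + t * z = z := fun z ↦ by rw [← add_mul, h2, one_mul]
  obtain ⟨σ, hσ, hσ2, hσm⟩ := exists_sign_unit hS₀ (fun i ↦ i % 4 = 0 ∨ i % 4 = 3)
  -- right multiplication by `Y` kills the entries of `A` at `(i, i + 1)`, `i` even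
  obtain ⟨Y, hY, hYh, hσY, -⟩ := exists_cayley_inverted hS₀ hσ hσ2
    (parityBand 0 (fun i ↦ -(t * (A : 𝕌) i (i + 1))) 0)
    (fun i ↦ by simp [parityBand_apply])
    (fun i ↦ by
      rw [parityBand_apply]
      split_ifs
      exacts [neg_mem (mul_mem (hS₀ ht) (hA.2 i).2), by omega, by omega, zero_mem _])
    (fun i j ↦ by
      rw [parityBand_apply]
      split_ifs <;> first | omega | simp)
  have hY1 : ∀ i, i % 2 = 0 → (Y : 𝕌) i (i + 1) = -(A : 𝕌) i (i + 1) := fun i hi ↦ by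
    have e := congrArg (fun f : 𝕌 ↦ f i (i + 1)) hYh
    simp only [incidence_mul_one, IncidenceAlgebra.sub_apply, IncidenceAlgebra.add_apply, hY.1,
      parityBand_apply, IncidenceAlgebra.one_apply] at e
    simp [hi] at e
    rw [← h2' ((A : 𝕌) i (i + 1)), neg_add, eq_sub_of_add_eq' e, sub_eq_add_neg]
  have hAY : A * Y ∈ bandUnipotent S₀ hS₀ := mul_mem hA hY
  set A₁ := A * Y with hA₁
  set a : 𝕌 := (A₁ : 𝕌) with ha
  have a0 : ∀ i, a i i = 1 := hAY.1
  have a01 : ∀ q, a (2 * q) (2 * q + 1) = 0 := fun q ↦ by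
    rw [ha, hA₁, Units.val_mul, incidence_mul_one, hA.1, hY.1, hY1 _ (by omega)]
    simp
  -- multiplication by `Z` leaves the entries `o` and `n` of `A₁` unchanged
  set o : ℕ → S := fun q ↦ a (2 * q + 1) (2 * q + 2) with ho
  set n : ℕ → S := fun q ↦ a (2 * q) (2 * q + 3) with hn
  -- the second superdiagonal of the factor `Z` below
  set c : ℕ → S := fun i ↦ (if i % 2 = 0 then 1 else 1 + o (i / 2) * n (i / 2)) - a i (i + 2)
    with hc
  -- the entries of `M` at `(2 q, 2 q + 4)`, `(2 q, 2 q + 5)` and `(2 q + 1, 2 q + 5)`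
  set e : ℕ → S := fun q ↦ a (2 * q) (2 * q + 4) + a (2 * q) (2 * q + 2) * c (2 * q + 2)
    + c (2 * q) * (t * c (2 * q + 2)) - t - n q * (t * o (q + 1)) with he
  set f : ℕ → S := fun q ↦ a (2 * q) (2 * q + 5) + a (2 * q) (2 * q + 3) * c (2 * q + 3)
    - t * n (q + 1) - n q * (t * (1 + o (q + 1) * n (q + 1))) with hf
  set g : ℕ → S := fun q ↦ a (2 * q + 1) (2 * q + 5) + a (2 * q + 1) (2 * q + 3) * c (2 * q + 3)
    + c (2 * q + 1) * (t * c (2 * q + 3)) - o q * (t * n (q + 1))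
    - (1 + o q * n q) * (t * (1 + o (q + 1) * n (q + 1))) with hg
  -- the entry of `M` at `(2 q + 1, 2 q + 4)`, up to the entry of `Z` at the same place
  set d : ℕ → S := fun q ↦ a (2 * q + 1) (2 * q + 4) + o q * c (2 * q + 2) - o q * t
    - (1 + o q * n q) * (t * o (q + 1)) with hd
  obtain ⟨α, β, γ, hα0, hβ0, hγ0, hα, hβ, hγ⟩ : ∃ α β γ : ℕ → S, α 0 = 0 ∧ β 0 = 0 ∧ γ 0 = 0 ∧
      (∀ q, α (q + 1) = e q + α q + β q * o (q + 1)) ∧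
      (∀ q, β (q + 1) =
        (1 + n q * o q) * (f q + α q * n (q + 1) + β q * (1 + o (q + 1) * n (q + 1)))
        - n q * (g q + γ q * (1 + o (q + 1) * n (q + 1)))) ∧
      (∀ q, γ (q + 1) = g q + γ q * (1 + o (q + 1) * n (q + 1))
        - o q * (f q + α q * n (q + 1) + β q * (1 + o (q + 1) * n (q + 1)))) := by
    let r : ℕ → S × S × S := fun q ↦ Nat.rec (0, 0, 0) (fun q s ↦
      (e q + s.1 + s.2.1 * o (q + 1),
        (1 + n q * o q) * (f q + s.1 * n (q + 1) + s.2.1 * (1 + o (q + 1) * n (q + 1)))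
          - n q * (g q + s.2.2 * (1 + o (q + 1) * n (q + 1))),
        g q + s.2.2 * (1 + o (q + 1) * n (q + 1))
          - o q * (f q + s.1 * n (q + 1) + s.2.1 * (1 + o (q + 1) * n (q + 1))))) q
    exact ⟨fun q ↦ (r q).1, fun q ↦ (r q).2.1, fun q ↦ (r q).2.2, rfl, rfl, rfl, fun _ ↦ rfl,
      fun _ ↦ rfl, fun _ ↦ rfl⟩
  -- the entry of `Z` at `(2 q + 1, 2 q + 4)`, solving the compatibility condition `hc` of
  -- `exists_conj_blockShift`
  set l : ℕ → S := fun q ↦ o q * (e q + α q + β q * o (q + 1)) - γ q * o (q + 1) - d q with hl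
  set h : 𝕌 := incidenceOfFun fun i j ↦ if j = i + 2 then t * c i
    else if i % 2 = 1 ∧ j = i + 3 then t * l (i / 2) else 0 with hh
  have hhe : ∀ i j, h i j = if j = i + 2 then t * c i
      else if i % 2 = 1 ∧ j = i + 3 then t * l (i / 2) else 0 := fun i j ↦ by
    by_cases hij : i ≤ j
    · exact incidenceOfFun_apply _ hij
    · rw [IncidenceAlgebra.apply_eq_zero_of_not_le hij, if_neg (by omega), if_neg (by omega)]
  clear_value h
  obtain ⟨Z, hZ, hZh, hσZ, -⟩ := exists_cayley_inverted hS₀ hσ hσ2 h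
    (fun i ↦ by simp [hhe])
    (fun i ↦ by
      rw [hhe, if_neg (by omega), if_neg (by omega)]
      exact zero_mem _)
    (fun i j ↦ by
      rw [hhe]
      split_ifs <;> first | omega | simp)
  have hZh' : (Z : 𝕌) = 1 + h + Z * h := by
    rw [mul_sub, mul_one, sub_eq_iff_eq_add] at hZh
    exact hZh
  have hZe : ∀ i d, d ≠ 0 → (Z : 𝕌) i (i + d) = h i (i + d) + ((Z : 𝕌) * h) i (i + d) :=
    fun i d hd ↦ by
      conv_lhs => rw [hZh']
      rw [IncidenceAlgebra.add_apply, IncidenceAlgebra.add_apply, incidence_apply_add_ne i d hd,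
        zero_add]
  have h0 : ∀ i, h i i = 0 := fun i ↦ by simp [hhe]
  have h1 : ∀ i, h i (i + 1) = 0 := fun i ↦ by simp [hhe]
  have hh2 : ∀ i, h i (i + 2) = t * c i := fun i ↦ by simp [hhe]
  have h3e : ∀ i, i % 2 = 0 → h i (i + 3) = 0 := fun i hi ↦ by simp [hhe, hi]
  have h3o : ∀ i, i % 2 = 1 → h i (i + 3) = t * l (i / 2) := fun i hi ↦ by simp [hhe, hi]
  have h4 : ∀ i, h i (i + 4) = 0 := fun i ↦ by simp [hhe]
  have h5 : ∀ i, h i (i + 5) = 0 := fun i ↦ by simp [hhe]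
  have z1 : ∀ i, (Z : 𝕌) i (i + 1) = 0 := fun i ↦ by
    rw [hZe i 1 one_ne_zero, incidence_mul_one, h1, h0]; simp
  have z2 : ∀ i, (Z : 𝕌) i (i + 2) = c i := fun i ↦ by
    rw [hZe i 2 two_ne_zero, incidence_mul_two, z1, h0, hh2, hZ.1]; simp [h2']
  have z3e : ∀ i, i % 2 = 0 → (Z : 𝕌) i (i + 3) = 0 := fun i hi ↦ by
    rw [hZe i 3 three_ne_zero, incidence_mul_three, z1, h0, h3e i hi,
      show h (i + 2) (i + 3) = 0 from h1 _]
    simp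
  have z3o : ∀ i, i % 2 = 1 → (Z : 𝕌) i (i + 3) = l (i / 2) := fun i hi ↦ by
    rw [hZe i 3 three_ne_zero, incidence_mul_three, z1, h0, h3o i hi,
      show h (i + 2) (i + 3) = 0 from h1 _, hZ.1]
    simp [h2']
  have z4 : ∀ i, (Z : 𝕌) i (i + 4) = c i * (t * c (i + 2)) := fun i ↦ by
    rw [hZe i 4 four_ne_zero, incidence_mul_four, z1, h0, h4, z2,
      show h (i + 2) (i + 4) = _ from hh2 _, show h (i + 3) (i + 4) = 0 from h1 _]
    simp
  have z5 : ∀ i, i % 2 = 0 → (Z : 𝕌) i (i + 5) = 0 := fun i hi ↦ by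
    rw [hZe i 5 (by norm_num), incidence_mul_five, z1, h0, h5, z3e i hi,
      show h (i + 2) (i + 5) = _ from h3e _ (by omega), show h (i + 4) (i + 5) = 0 from h1 _]
    simp
  have hX := mul_mem hAY hZ
  set X := A₁ * Z with hXdef
  -- the entries of `X` near the diagonal
  have x01 : ∀ q, (X : 𝕌) (2 * q) (2 * q + 1) = 0 := fun q ↦ by
    rw [hXdef, Units.val_mul, incidence_mul_one, ← ha, a01, z1]; simp
  have x12 : ∀ q, (X : 𝕌) (2 * q + 1) (2 * q + 2) = o q := fun q ↦ by
    rw [hXdef, Units.val_mul, incidence_mul_one _ _ (2 * q + 1), ← ha, z1, hZ.1]; simp [ho]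
  have x02 : ∀ q, (X : 𝕌) (2 * q) (2 * q + 2) = 1 := fun q ↦ by
    rw [hXdef, Units.val_mul, incidence_mul_two, ← ha, a01, z2, hZ.1, a0]; simp [hc]
  have x13 : ∀ q, (X : 𝕌) (2 * q + 1) (2 * q + 3) = 1 + o q * n q := fun q ↦ by
    have e1 : (Z : 𝕌) (2 * q + 2) (2 * q + 3) = 0 := z1 _
    rw [hXdef, Units.val_mul, incidence_mul_two _ _ (2 * q + 1), ← ha, e1, z2, hZ.1, a0]
    simp [hc, show (2 * q + 1) % 2 = 1 by omega, show (2 * q + 1) / 2 = q by omega]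
  have x03 : ∀ q, (X : 𝕌) (2 * q) (2 * q + 3) = n q := fun q ↦ by
    have e1 : (Z : 𝕌) (2 * q + 2) (2 * q + 3) = 0 := z1 _
    rw [hXdef, Units.val_mul, incidence_mul_three, ← ha, a01, z3e _ (by omega), e1, hZ.1, a0]
    simp [hn]
  have x14 : ∀ q, (X : 𝕌) (2 * q + 1) (2 * q + 4) =
      a (2 * q + 1) (2 * q + 4) + o q * c (2 * q + 2) + l q := fun q ↦ by
    have e1 : (Z : 𝕌) (2 * q + 2) (2 * q + 4) = c (2 * q + 2) := z2 _
    have e2 : (Z : 𝕌) (2 * q + 3) (2 * q + 4) = 0 := z1 _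
    have e3 : (Z : 𝕌) (2 * q + 1) (2 * q + 4) = l q := by
      rw [z3o (2 * q + 1) (by omega), show (2 * q + 1) / 2 = q by omega]
    rw [hXdef, Units.val_mul, incidence_mul_three _ _ (2 * q + 1), ← ha, e1, e2, e3, hZ.1, a0]
    simp only [ho]
    simp
    abel
  have x04 : ∀ q, (X : 𝕌) (2 * q) (2 * q + 4) = a (2 * q) (2 * q + 4)
      + a (2 * q) (2 * q + 2) * c (2 * q + 2) + c (2 * q) * (t * c (2 * q + 2)) := fun q ↦ by
    have e1 : (Z : 𝕌) (2 * q + 2) (2 * q + 4) = c (2 * q + 2) := z2 _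
    have e2 : (Z : 𝕌) (2 * q + 3) (2 * q + 4) = 0 := z1 _
    rw [hXdef, Units.val_mul, incidence_mul_four, ← ha, e1, e2, z4, hZ.1, a0, a01]
    simp
    abel
  have x05 : ∀ q, (X : 𝕌) (2 * q) (2 * q + 5) = a (2 * q) (2 * q + 5)
      + a (2 * q) (2 * q + 3) * c (2 * q + 3) := fun q ↦ by
    have e1 : (Z : 𝕌) (2 * q + 2) (2 * q + 5) = 0 := z3e _ (by omega)
    have e2 : (Z : 𝕌) (2 * q + 3) (2 * q + 5) = c (2 * q + 3) := z2 _
    have e3 : (Z : 𝕌) (2 * q + 4) (2 * q + 5) = 0 := z1 _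
    rw [hXdef, Units.val_mul, incidence_mul_five, ← ha, e1, e2, e3, z5 _ (by omega), hZ.1, a0, a01]
    simp
    abel
  have x15 : ∀ q, (X : 𝕌) (2 * q + 1) (2 * q + 5) = a (2 * q + 1) (2 * q + 5)
      + a (2 * q + 1) (2 * q + 3) * c (2 * q + 3)
      + c (2 * q + 1) * (t * c (2 * q + 3)) := fun q ↦ by
    have e1 : (Z : 𝕌) (2 * q + 2) (2 * q + 5) = 0 := z3e _ (by omega)
    have e2 : (Z : 𝕌) (2 * q + 3) (2 * q + 5) = c (2 * q + 3) := z2 _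
    have e3 : (Z : 𝕌) (2 * q + 4) (2 * q + 5) = 0 := z1 _
    rw [hXdef, Units.val_mul, incidence_mul_four _ _ (2 * q + 1), ← ha, e1, e2, e3, z4, hZ.1, a0]
    simp
    abel
  -- `M` is twice the inverse Cayley transform of `X`
  set N : 𝕌 := incidenceDiagonal (fun _ ↦ t) * ((X : 𝕌) - 1) with hN
  have hNe : ∀ i d, d ≠ 0 → N i (i + d) = t * (X : 𝕌) i (i + d) := fun i d hd ↦ by
    rw [hN, incidenceDiagonal_mul, IncidenceAlgebra.sub_apply, incidence_apply_add_ne i d hd,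
      sub_zero]
  have hN0 : ∀ i, N i i = 0 := fun i ↦ by
    rw [hN, incidenceDiagonal_mul, IncidenceAlgebra.sub_apply, hX.1]; simp
  obtain ⟨G, hG⟩ := exists_unit_of_unipotent (1 + N) (fun i ↦ by
    rw [IncidenceAlgebra.add_apply, hN0]; simp)
  set M : 𝕌 := ((X : 𝕌) - 1) * ((G⁻¹ : 𝕌ˣ) : 𝕌) with hM
  have hMG : M * (1 + N) = X - 1 := by rw [hM, ← hG, mul_assoc, Units.inv_mul, mul_one]
  have hMe : ∀ i d, d ≠ 0 → M i (i + d) = (X : 𝕌) i (i + d) - (M * N) i (i + d) := fun i d hd ↦ by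
    have e1 := congrArg (fun f : 𝕌 ↦ f i (i + d)) hMG
    simp only [mul_add, mul_one, IncidenceAlgebra.add_apply, IncidenceAlgebra.sub_apply,
      incidence_apply_add_ne i d hd, sub_zero] at e1
    rw [← e1, add_sub_cancel_right]
  have hM0 : ∀ i, M i i = 0 := fun i ↦ by
    rw [hM, incidence_mul_self, IncidenceAlgebra.sub_apply, hX.1]; simp
  have m01 : ∀ q, M (2 * q) (2 * q + 1) = 0 := fun q ↦ by
    rw [hMe _ 1 one_ne_zero, incidence_mul_one, hM0, hN0, x01]; simp
  have m12 : ∀ q, M (2 * q + 1) (2 * q + 2) = o q := fun q ↦ by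
    rw [hMe (2 * q + 1) 1 one_ne_zero, incidence_mul_one, hM0, hN0, x12]; simp
  have m02 : ∀ q, M (2 * q) (2 * q + 2) = 1 := fun q ↦ by
    rw [hMe _ 2 two_ne_zero, incidence_mul_two, hM0, hN0, x02, m01]; simp
  have n23 : ∀ q, N (2 * q + 2) (2 * q + 3) = 0 := fun q ↦ by
    rw [hNe (2 * q + 2) 1 one_ne_zero, show (X : 𝕌) (2 * q + 2) (2 * q + 2 + 1) = 0 from
      x01 (q + 1), mul_zero]
  have n34 : ∀ q, N (2 * q + 3) (2 * q + 4) = t * o (q + 1) := fun q ↦ by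
    rw [hNe (2 * q + 3) 1 one_ne_zero, ← x12 (q + 1)]; rfl
  have n24 : ∀ q, N (2 * q + 2) (2 * q + 4) = t := fun q ↦ by
    rw [hNe (2 * q + 2) 2 two_ne_zero, show (X : 𝕌) (2 * q + 2) (2 * q + 2 + 2) = 1 from
      x02 (q + 1), mul_one]
  have n25 : ∀ q, N (2 * q + 2) (2 * q + 5) = t * n (q + 1) := fun q ↦ by
    rw [hNe (2 * q + 2) 3 three_ne_zero, ← x03 (q + 1)]; rfl
  have n35 : ∀ q, N (2 * q + 3) (2 * q + 5) = t * (1 + o (q + 1) * n (q + 1)) := fun q ↦ by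
    rw [hNe (2 * q + 3) 2 two_ne_zero, ← x13 (q + 1)]; rfl
  have n45 : ∀ q, N (2 * q + 4) (2 * q + 5) = 0 := fun q ↦ n23 (q + 1)
  have m03 : ∀ q, M (2 * q) (2 * q + 3) = n q := fun q ↦ by
    rw [hMe _ 3 three_ne_zero, incidence_mul_three, hM0, hN0, x03, m01, n23]; simp
  have m13 : ∀ q, M (2 * q + 1) (2 * q + 3) = 1 + o q * n q := fun q ↦ by
    rw [hMe (2 * q + 1) 2 two_ne_zero, incidence_mul_two, hM0, hN0, n23, x13]; simp
  have m04 : ∀ q, M (2 * q) (2 * q + 4) = e q := fun q ↦ by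
    rw [hMe _ 4 four_ne_zero, incidence_mul_four, hM0, hN0, m01, m02, m03, n24, n34, x04]
    simp only [he]
    noncomm_ring
  have m05 : ∀ q, M (2 * q) (2 * q + 5) = f q := fun q ↦ by
    rw [hMe _ 5 (by norm_num), incidence_mul_five, hM0, hN0, m01, m02, m03, n25, n35, n45, x05]
    simp only [hf]
    noncomm_ring
  have m15 : ∀ q, M (2 * q + 1) (2 * q + 5) = g q := fun q ↦ by
    rw [hMe (2 * q + 1) 4 four_ne_zero, incidence_mul_four, hM0, hN0, m12, m13, n25, n35, n45, x15]
    simp only [hg]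
    noncomm_ring
  have m14 : ∀ q, M (2 * q + 1) (2 * q + 4) = d q + l q := fun q ↦ by
    rw [hMe (2 * q + 1) 3 three_ne_zero, incidence_mul_three, hM0, hN0, m12, m13, n24, n34, x14]
    simp only [hd]
    noncomm_ring
  obtain ⟨P, hP, hP1, hPM⟩ := exists_conj_blockShift M o n α β γ hM0 m01 m12 m02 m03 m13
    hα0 hβ0 hγ0 (fun q ↦ by rw [m04]; exact hα q) (fun q ↦ by rw [m05, m15]; exact hβ q)
    (fun q ↦ by rw [m05, m15]; exact hγ q) (fun q ↦ by
      rw [m14, m04]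
      simp only [hl]
      noncomm_ring)
  obtain ⟨P, hPm, rfl⟩ := exists_mem_bandUnipotent hS₀ P hP (fun i ↦ by
    rw [hP1]; exact zero_mem _)
  have hX1 := isCommutatorOf_of_conj_blockShift hS₀ ht h2 (fun q ↦ (hAY.2 (2 * q + 1)).2) hPm
    hMG hPM
  -- the remaining factor is a product of two matrices inverted by `σ`
  have hinv : ∀ y : 𝕌ˣ, σ * y * σ = y⁻¹ → σ * y⁻¹ * σ = y⁻¹⁻¹ := fun y hy ↦ by
    have hσinv : σ⁻¹ = σ := inv_eq_of_mul_eq_one_right hσ2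
    calc σ * y⁻¹ * σ = (σ⁻¹ * y * σ⁻¹)⁻¹ := by group
      _ = y⁻¹⁻¹ := by rw [hσinv, hy]
  obtain ⟨τ, hτm, hτ2, hτ⟩ := exists_involution_mul_inverted ht h2 (inv_mem hZ) hσm hσ2
    (hinv Z hσZ) (hinv Y hσY)
  have hX2 := isCommutatorOf_of_inverted ht h2 (mul_mem (inv_mem hZ) (inv_mem hY)) hτm hτ2 hτ
  refine ⟨[↑X, ↑(Z⁻¹ * Y⁻¹)], le_rfl, ?_, ?_⟩
  · simp only [List.forall_mem_cons, List.not_mem_nil, false_imp_iff, implies_true, and_true]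
    exact ⟨hX1, hX2⟩
  · rw [List.prod_cons, List.prod_singleton, ← Units.val_mul, hXdef, hA₁]
    exact congrArg Units.val (by group)

end TwoCommutators

/-! ### Transfer of commutator products along ring homomorphisms -/

section Transfer

variable {M N : Type*} [Ring M] [Ring N]

lemma IsProdOfCommutators.map (f : M →+* N) {r : ℕ} {P Q : M → Prop} {P' Q' : N → Prop}
    (hP : ∀ x, P x → P' (f x)) (hQ : ∀ x, Q x → Q' (f x)) {A : M}
    (h : IsProdOfCommutators r P Q A) : IsProdOfCommutators r P' Q' (f A) := by
  obtain ⟨l, hl, hc, rfl⟩ := h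
  refine ⟨l.map f, by simpa using hl, ?_, (map_list_prod f l).symm⟩
  simp only [List.mem_map]
  rintro _ ⟨x, hx, rfl⟩
  obtain ⟨B, C, hB, hC, rfl⟩ := hc x hx
  refine ⟨Units.map (f : M →* N) B, Units.map (f : M →* N) C, hP _ hB, hQ _ hC, ?_⟩
  rw [← map_inv, ← map_inv, ← map_mul, ← map_mul, ← map_mul]
  rfl

lemma IsProdOfCommutators.mono {r r' : ℕ} (hr : r ≤ r') {P Q : M → Prop} {A : M}
    (h : IsProdOfCommutators r P Q A) : IsProdOfCommutators r' P Q A := by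
  obtain ⟨l, hl, h⟩ := h
  exact ⟨l, hl.trans hr, h⟩

/-- Multiplying the first entry of each commutator by a central unit changes nothing. -/
lemma IsProdOfCommutators.mul_central {r : ℕ} {P P' Q : M → Prop} {A : M} (z : Mˣ)
    (hz : ∀ x, (z : M) * x = x * z) (hP : ∀ x, P x → P' (z * x))
    (h : IsProdOfCommutators r P Q A) : IsProdOfCommutators r P' Q A := by
  obtain ⟨l, hl, hc, rfl⟩ := h
  refine ⟨l, hl, fun x hx ↦ ?_, rfl⟩
  obtain ⟨B, C, hB, hC, rfl⟩ := hc x hx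
  have hzC : z * C = C * z := Units.ext (hz C)
  have hzB : z * B = B * z := Units.ext (hz B)
  refine ⟨z * B, C, hP _ hB, hC, congrArg Units.val ?_⟩
  calc B * C * B⁻¹ * C⁻¹ = B * (C * z) * z⁻¹ * B⁻¹ * C⁻¹ := by group
    _ = (B * z) * C * (z⁻¹ * B⁻¹) * C⁻¹ := by rw [← hzC]; group
    _ = (z * B) * C * (z * B)⁻¹ * C⁻¹ := by rw [← hzB, ← mul_inv_rev, ← hzB]

/-- Products of commutators of elements of order `k` can be pulled back along an injective
homomorphism, if the set that contains these elements lies in its image. -/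
lemma IsProdOfCommutators.of_map (f : M →+* N) (hf : Function.Injective f) {r k : ℕ}
    (hk : k ≠ 0) {T : Set M} {T' : Set N} (hT : ∀ y ∈ T', ∃ x ∈ T, f x = y) {A : M}
    (h : IsProdOfCommutators r (HasOrderIn T' k) (HasOrderIn T' k) (f A)) :
    IsProdOfCommutators r (HasOrderIn T k) (HasOrderIn T k) A := by
  obtain ⟨l, hl, hc, hA⟩ := h
  have hlift : ∀ B : Nˣ, HasOrderIn T' k (B : N) →
      ∃ b : Mˣ, HasOrderIn T k (b : M) ∧ Units.map f b = B := fun B hB ↦ by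
    obtain ⟨b, hb, hbB⟩ := hT _ hB.1
    have hbk : b ^ k = 1 := hf (by rw [map_pow, hbB, hB.2, map_one])
    exact ⟨Units.ofPowEqOne b k hbk hk, ⟨hb, hbk⟩, Units.ext hbB⟩
  have hcl : ∀ x ∈ l, ∃ y, IsCommutatorOf (HasOrderIn T k) (HasOrderIn T k) y ∧ f y = x := by
    intro x hx
    obtain ⟨B, C, hB, hC, rfl⟩ := hc x hx
    obtain ⟨b, hb, rfl⟩ := hlift B hB
    obtain ⟨c, hc, rfl⟩ := hlift C hC
    refine ⟨_, ⟨b, c, hb, hc, rfl⟩, ?_⟩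
    rw [← map_inv, ← map_inv, ← map_mul, ← map_mul, ← map_mul]; rfl
  choose! y hy hyx using hcl
  refine ⟨l.map y, by simpa using hl, ?_, hf ?_⟩
  · simp only [List.mem_map]
    rintro _ ⟨x, hx, rfl⟩
    exact hy x hx
  · rw [map_list_prod, List.map_map, ← hA]
    exact congrArg List.prod ((List.map_congr_left hyx).trans (List.map_id l))

end Transfer

/-! ### Partition into blocks and leading corners -/

section Blocks

variable {R S : Type*} [Ring R] [Ring S]

/-- The partition of an upper triangular infinite matrix over `R` into `m × m` blocks. The ring of
blocks is any ring `S` with an identification `e` with the matrix ring, so that statements about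
matrices over an abstract ring apply to it as they stand. -/
def blockHom {m : ℕ} (e : S ≃+* Matrix (Fin m) (Fin m) R) :
    IncidenceAlgebra R ℕ →+* IncidenceAlgebra S ℕ where
  toFun g := ⟨fun p q ↦ e.symm (Matrix.of fun a b ↦ g (p * m + a) (q * m + b)), fun p q h ↦ by
    rw [← map_zero e.symm]
    refine congrArg _ ?_
    ext a b
    have : q * m + m ≤ p * m := by nlinarith
    exact IncidenceAlgebra.apply_eq_zero_of_not_le (by omega) g⟩
  map_one' := by
    ext p q _
    rw [← e.injective.eq_iff]
    change e (e.symm _) = _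
    rw [e.apply_symm_apply]
    ext a b
    have hm : 0 < m := a.pos
    have key : p * m + a = q * m + b ↔ p = q ∧ a = b := by
      refine ⟨fun h ↦ ?_, fun ⟨h, h'⟩ ↦ by rw [h, h']⟩
      have hd : p = q := by
        have := congrArg (· / m) h
        simpa [mul_comm _ m, Nat.mul_add_div hm, Nat.div_eq_of_lt a.2, Nat.div_eq_of_lt b.2]
          using this
      subst hd
      exact ⟨rfl, Fin.ext (by omega)⟩
    rw [Matrix.of_apply, IncidenceAlgebra.one_apply, IncidenceAlgebra.one_apply]
    simp only [key]
    by_cases hpq : p = q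
    · simp only [hpq, true_and, if_true, map_one, Matrix.one_apply]
    · simp only [hpq, false_and, if_false, map_zero, Matrix.zero_apply]
  map_zero' := by
    ext p q _
    exact map_zero e.symm
  map_add' _ _ := by
    ext p q _
    exact map_add e.symm _ _
  map_mul' f g := by
    ext p q hpq
    rw [IncidenceAlgebra.mul_apply, ← e.injective.eq_iff, map_sum]
    simp only [map_mul, IncidenceAlgebra.coe_mk, e.apply_symm_apply]
    ext a b
    have hm : 0 < m := a.pos
    simp only [IncidenceAlgebra.mul_apply, Matrix.sum_apply, Matrix.mul_apply, Matrix.of_apply]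
    rw [← Finset.sum_product' (Finset.Icc p q) Finset.univ
      fun r (c : Fin m) ↦ f (p * m + a) (r * m + c) * g (r * m + c) (q * m + b)]
    refine Finset.sum_of_injOn (fun x ↦ (x / m, ⟨x % m, Nat.mod_lt _ hm⟩)) ?_ ?_ ?_ ?_
    · intro x _ y _ h
      simp only [Prod.mk.injEq, Fin.mk.injEq] at h
      rw [← Nat.div_add_mod x m, ← Nat.div_add_mod y m, h.1, h.2]
    · intro x hx
      simp only [Finset.coe_Icc, Set.mem_Icc] at hx
      simp only [Finset.coe_product, Set.mem_prod, Finset.coe_Icc, Set.mem_Icc, Finset.coe_univ,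
        Set.mem_univ, and_true]
      refine ⟨(Nat.le_div_iff_mul_le hm).2 (by omega), ?_⟩
      exact Nat.lt_succ_iff.1 ((Nat.div_lt_iff_lt_mul hm).2 (by rw [Nat.succ_mul]; omega))
    · rintro ⟨r, c⟩ _ h
      have hrc : r * m + c ∉ Finset.Icc (p * m + a) (q * m + b) := fun h' ↦ by
        refine h ⟨r * m + c, h', ?_⟩
        rw [mul_comm, Prod.mk.injEq]
        exact ⟨by rw [Nat.mul_add_div hm, Nat.div_eq_of_lt c.2, add_zero],
          Fin.ext (by simp [Nat.mod_eq_of_lt c.2])⟩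
      rw [Finset.mem_Icc, not_and_or] at hrc
      rcases hrc with hrc | hrc
      · rw [IncidenceAlgebra.apply_eq_zero_of_not_le hrc, zero_mul]
      · rw [IncidenceAlgebra.apply_eq_zero_of_not_le hrc, mul_zero]
    · intro x _
      simp only [Nat.div_add_mod']

lemma blockHom_apply {m : ℕ} (e : S ≃+* Matrix (Fin m) (Fin m) R) (g : IncidenceAlgebra R ℕ)
    (p q : ℕ) (a b : Fin m) : e (blockHom e g p q) a b = g (p * m + a) (q * m + b) :=
  congrFun (congrFun (e.apply_symm_apply _) a) b

/-- The leading `n × n` corner of an upper triangular infinite matrix. -/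
def cornerHom (n : ℕ) : IncidenceAlgebra R ℕ →+* Matrix (Fin n) (Fin n) R where
  toFun g := Matrix.of fun i j ↦ g i j
  map_one' := by
    ext i j
    simp [Matrix.one_apply, Fin.ext_iff]
  map_zero' := rfl
  map_add' _ _ := rfl
  map_mul' f g := by
    ext i j
    change (f * g) i j = ∑ l : Fin n, f i l * g l j
    rw [IncidenceAlgebra.mul_apply, Fin.sum_univ_eq_sum_range (fun l ↦ f i l * g l j) n]
    refine Finset.sum_subset (fun x hx ↦ ?_) fun x _ hx ↦ ?_
    · rw [Finset.mem_Icc] at hx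
      exact Finset.mem_range.2 (hx.2.trans_lt j.2)
    · rw [Finset.mem_Icc, not_and_or] at hx
      rcases hx with hx | hx
      · rw [IncidenceAlgebra.apply_eq_zero_of_not_le hx, zero_mul]
      · rw [IncidenceAlgebra.apply_eq_zero_of_not_le hx, mul_zero]

lemma cornerHom_apply (n : ℕ) (g : IncidenceAlgebra R ℕ) (i j : Fin n) :
    cornerHom n g i j = g i j := rfl

lemma blockHom_injective {m : ℕ} (hm : 1 ≤ m) (e : S ≃+* Matrix (Fin m) (Fin m) R) :
    Function.Injective (blockHom e) := by
  intro f g h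
  ext i j _
  have h' : e (blockHom e f (i / m) (j / m)) ⟨i % m, Nat.mod_lt _ hm⟩ ⟨j % m, Nat.mod_lt _ hm⟩ =
      e (blockHom e g (i / m) (j / m)) ⟨i % m, Nat.mod_lt _ hm⟩ ⟨j % m, Nat.mod_lt _ hm⟩ := by
    rw [h]
  rw [blockHom_apply, blockHom_apply] at h'
  simpa only [Nat.div_add_mod'] using h'

/-- The upper triangular blocks. -/
def upperTriangularSubring {m : ℕ} (e : S ≃+* Matrix (Fin m) (Fin m) R) : Subring S where
  carrier := {g | ∀ a b, b < a → e g a b = 0}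
  mul_mem' {f g} hf hg a b h := by
    rw [map_mul, Matrix.mul_apply]
    refine Finset.sum_eq_zero fun c _ ↦ ?_
    rcases lt_or_ge c a with hc | hc
    · rw [hf a c hc, zero_mul]
    · rw [hg c b (h.trans_le hc), mul_zero]
  one_mem' a b h := by rw [map_one, Matrix.one_apply_ne h.ne']
  add_mem' {f g} hf hg a b h := by rw [map_add, Matrix.add_apply, hf a b h, hg a b h, add_zero]
  zero_mem' a b h := by rw [map_zero, Matrix.zero_apply]
  neg_mem' {f} hf a b h := by rw [map_neg, Matrix.neg_apply, hf a b h, neg_zero]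

lemma apply_eq_zero_of_mem_center {m : ℕ} (e : S ≃+* Matrix (Fin m) (Fin m) R) {g : S}
    (hg : g ∈ Subring.center S) {a b : Fin m} (h : a ≠ b) : e g a b = 0 := by
  have hc := congrArg e (Subring.mem_center_iff.1 hg (e.symm (Matrix.single a a 1)))
  rw [map_mul, map_mul, e.apply_symm_apply] at hc
  simpa [Matrix.mul_apply, Matrix.single_apply, h] using congrFun (congrFun hc a) b

lemma center_le_upperTriangularSubring {m : ℕ} (e : S ≃+* Matrix (Fin m) (Fin m) R) :
    Subring.center S ≤ upperTriangularSubring e :=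
  fun _ hg _ _ h ↦ apply_eq_zero_of_mem_center e hg h.ne'

lemma symm_scalar_mem_center {m : ℕ} (e : S ≃+* Matrix (Fin m) (Fin m) R) {z : R}
    (hz : z ∈ Subring.center R) : e.symm (Matrix.scalar (Fin m) z) ∈ Subring.center S :=
  Subring.mem_center_iff.2 fun g ↦ e.injective <| by
    rw [map_mul, map_mul, e.apply_symm_apply]
    exact (Matrix.scalar_commute z (fun r ↦ (Subring.mem_center_iff.1 hz r).symm) (e g)).eq.symm

lemma blockHom_mem_bandSubring {m : ℕ} (e : S ≃+* Matrix (Fin m) (Fin m) R)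
    {g : IncidenceAlgebra R ℕ} (hg : g ∈ UTInf R m) :
    (∀ p, blockHom e g p p = 1) ∧ ∀ p, blockHom e g p (p + 1) ∈ upperTriangularSubring e := by
  refine ⟨fun p ↦ e.injective ?_, fun p a b h ↦ ?_⟩
  · ext a b
    rw [blockHom_apply, map_one, Matrix.one_apply]
    rcases lt_trichotomy a b with h | rfl | h
    · rw [if_neg h.ne, hg.1 _ _ (by omega) (by omega)]
    · rw [if_pos rfl, hg.2]
    · rw [if_neg h.ne', IncidenceAlgebra.apply_eq_zero_of_not_le (by omega)]
  · rw [blockHom_apply, hg.1 _ _ (by rw [add_mul]; omega) (by rw [add_mul]; omega)]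

lemma exists_blockHom_eq {m : ℕ} (hm : 1 ≤ m) (e : S ≃+* Matrix (Fin m) (Fin m) R)
    {F : IncidenceAlgebra S ℕ}
    (hF : F ∈ bandSubring (upperTriangularSubring e) (center_le_upperTriangularSubring e)) :
    ∃ g ∈ TInf R m, blockHom e g = F := by
  have hlow : ∀ p q (a b : Fin m), q * m + b < p * m + a → e (F p q) a b = 0 := by
    intro p q a b h
    rcases lt_trichotomy p q with hpq | rfl | hpq
    · have : p * m + m ≤ q * m := by nlinarith
      omega
    · exact apply_eq_zero_of_mem_center e (hF p).1 (by rintro rfl; omega)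
    · rw [IncidenceAlgebra.apply_eq_zero_of_not_le (by omega), map_zero, Matrix.zero_apply]
  refine ⟨⟨fun i j ↦ e (F (i / m) (j / m)) ⟨i % m, Nat.mod_lt _ hm⟩ ⟨j % m, Nat.mod_lt _ hm⟩,
    fun i j h ↦ hlow _ _ _ _ (by simpa [Nat.div_add_mod'] using h)⟩, fun i j hij hjm ↦ ?_, ?_⟩
  · change e (F (i / m) (j / m)) ⟨i % m, Nat.mod_lt _ hm⟩ ⟨j % m, Nat.mod_lt _ hm⟩ = 0
    have hi := Nat.div_add_mod' i m
    have hj := Nat.div_add_mod' j m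
    have hi' := Nat.mod_lt i hm
    have hj' := Nat.mod_lt j hm
    have h1 : i / m ≤ j / m := Nat.div_le_div_right hij.le
    have h2 : j / m ≤ i / m + 1 := by
      rw [← Nat.add_div_right i hm]
      exact Nat.div_le_div_right hjm.le
    rcases (show j / m = i / m ∨ j / m = i / m + 1 by omega) with h | h
    · rw [h] at hj ⊢
      exact apply_eq_zero_of_mem_center e (hF _).1 (by
        intro h'
        rw [Fin.mk.injEq] at h'
        omega)
    · rw [h] at hj ⊢
      refine (hF _).2 _ _ ?_
      rw [add_mul] at hj
      rw [Fin.mk_lt_mk]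
      omega
  · ext p q _
    rw [← e.injective.eq_iff]
    ext a b
    rw [blockHom_apply]
    have hdm : ∀ (p : ℕ) (a : Fin m), (p * m + a) / m = p ∧ (p * m + a) % m = a := fun p a ↦ by
      constructor
      · rw [mul_comm, Nat.mul_add_div hm, Nat.div_eq_of_lt a.2, add_zero]
      · rw [mul_comm, Nat.mul_add_mod, Nat.mod_eq_of_lt a.2]
    change e (F ((p * m + a) / m) ((q * m + b) / m)) ⟨(p * m + a) % m, _⟩ ⟨(q * m + b) % m, _⟩ = _
    simp only [(hdm _ _).1, (hdm _ _).2]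

end Blocks

/-! ### Infinite matrices over `R` -/

section InfiniteCase

variable {R : Type*} [Ring R]

lemma incidence_pow_apply_self (g : IncidenceAlgebra R ℕ) (s i : ℕ) : (g ^ s) i i = g i i ^ s := by
  induction s with
  | zero => simp
  | succ s ih => rw [pow_succ, incidence_mul_self, ih, pow_succ]

/-- If `k` is invertible and `ω` is a central root of `1 + x + ⋯ + x ^ (k - 1)`, then `1 - ω` is
invertible, because it divides the value `k` of this polynomial at `1`. -/
lemma exists_central_inverse_one_sub {k : ℕ} (hk : IsUnit (k : R)) {ω : R}
    (hω : ω ∈ Subring.center R) (hsum : ∑ j ∈ Finset.range k, ω ^ j = 0) :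
    ∃ u ∈ Subring.center R, u * (1 - ω) = 1 := by
  obtain ⟨κ, hκ⟩ := hk
  have hκc : ((κ⁻¹ : Rˣ) : R) ∈ Subring.center R := Subring.mem_center_iff.2 fun z ↦ by
    have h : Commute (κ : R) z := by rw [hκ]; exact Nat.cast_commute k z
    exact (h.units_inv_left).eq.symm
  have hmem : ∑ j ∈ Finset.range k, ∑ i ∈ Finset.range j, ω ^ i ∈ Subring.center R :=
    sum_mem fun j _ ↦ sum_mem fun i _ ↦ pow_mem hω i
  refine ⟨(κ⁻¹ : Rˣ) * ∑ j ∈ Finset.range k, ∑ i ∈ Finset.range j, ω ^ i,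
    mul_mem hκc hmem, ?_⟩
  rw [mul_assoc, Finset.sum_mul]
  simp only [geom_sum_mul_neg]
  rw [Finset.sum_sub_distrib, hsum, sub_zero, Finset.sum_const, Finset.card_range, nsmul_one, ← hκ,
    Units.inv_mul]

/-- The case of the blocks forming the ring `S`; it is applied to `S` the matrix ring itself. -/
lemma isProdOfCommutators_UTInf_of_ringEquiv {S : Type*} [Ring S] {m k : ℕ} (hm : 1 ≤ m)
    (e : S ≃+* Matrix (Fin m) (Fin m) R) (hk : 2 ≤ k) (hkR : IsUnit (k : R))
    {ω : R} (hω : ω ∈ Subring.center R) (hsum : ∑ j ∈ Finset.range k, ω ^ j = 0)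
    {A : IncidenceAlgebra R ℕ} (hA : A ∈ UTInf R m) :
    IsProdOfCommutators (4 * k - 6) (HasOrderIn (TInf R m) k) (HasOrderIn (TInf R m) k) A := by
  have hblock := blockHom_mem_bandSubring e hA
  obtain ⟨B, hB, hBA⟩ := exists_mem_bandUnipotent (center_le_upperTriangularSubring e)
    (blockHom e A) hblock.1 hblock.2
  refine IsProdOfCommutators.of_map (blockHom e) (blockHom_injective hm e) (by omega)
    (fun F hF ↦ exists_blockHom_eq hm e (SetLike.mem_coe.1 hF)) ?_
  rw [← hBA]
  obtain ⟨u, hu, huω⟩ := exists_central_inverse_one_sub hkR hω hsum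
  set φ : R →+* S := (e.symm : Matrix (Fin m) (Fin m) R →+* S).comp (Matrix.scalar (Fin m))
  have hφ : ∀ z ∈ Subring.center R, φ z ∈ Subring.center S := fun z ↦ symm_scalar_mem_center e
  have huω' : φ u * (1 - φ ω) = 1 := by rw [← map_one φ, ← map_sub, ← map_mul, huω]
  rcases hk.eq_or_lt with rfl | hk3
  · -- for `k = 2` one has `ω = -1`, so that the inverse of `1 - ω` is `1 / 2`
    have hω1 : ω = -1 := by
      rw [Finset.sum_range_succ, Finset.sum_range_one, pow_zero, pow_one] at hsum
      exact eq_neg_of_add_eq_zero_right hsum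
    refine isProdOfCommutators_two _ (hφ u hu) ?_ hB
    rw [← huω', hω1, map_neg, map_one, sub_neg_eq_add, mul_add, mul_one]
  · have hωk : φ ω ^ k = 1 := by
      have := geom_sum_mul ω k
      rw [hsum, zero_mul] at this
      rw [← map_pow, sub_eq_zero.1 this.symm, map_one]
    exact (isProdOfCommutators_six _ (by omega) (hφ ω hω) (hφ u hu) hωk huω' hB).mono (by omega)

theorem isProdOfCommutators_UTInf {m k : ℕ} (hm : 1 ≤ m) (hk : 2 ≤ k) (hkR : IsUnit (k : R))
    {ω : R} (hω : ω ∈ Subring.center R) (hsum : ∑ j ∈ Finset.range k, ω ^ j = 0)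
    {A : IncidenceAlgebra R ℕ} (hA : A ∈ UTInf R m) :
    IsProdOfCommutators (4 * k - 6) (HasOrderIn (UTRootInf R k m) k)
      (HasOrderIn (UTRootInf R k m) k) A := by
  have himp : ∀ x, HasOrderIn (TInf R m) k x → HasOrderIn (UTRootInf R k m) k x :=
    fun x hx ↦ ⟨⟨hx.1, fun i ↦ by rw [← incidence_pow_apply_self, hx.2]; simp⟩, hx.2⟩
  exact (isProdOfCommutators_UTInf_of_ringEquiv hm (RingEquiv.refl _) hk hkR hω hsum hA).map
    (RingHom.id _) himp himp

lemma HasOrderIn.pmUTInf {m s : ℕ} {x : IncidenceAlgebra R ℕ}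
    (hx : HasOrderIn (UTRootInf R s m) s x) : HasOrderIn (PMUTInf R s m) s x :=
  ⟨⟨hx.1.1, fun i ↦ Or.inl (hx.1.2 i)⟩, hx.2⟩

/-- A central `ζ` with `ζ ^ s = -1` turns the elements of order `s` into elements of skew order
`s`. -/
lemma IsProdOfCommutators.skew {m s r : ℕ} {ζ : R} (hζ : ζ ∈ Subring.center R) (hs : s ≠ 0)
    (hζs : ζ ^ s = -1) {A : IncidenceAlgebra R ℕ}
    (h : IsProdOfCommutators r (HasOrderIn (UTRootInf R s m) s)
      (HasOrderIn (UTRootInf R s m) s) A) :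
    IsProdOfCommutators r (HasSkewOrderIn (PMUTInf R s m) s) (HasOrderIn (PMUTInf R s m) s) A := by
  have hD : incidenceDiagonal (fun _ : ℕ ↦ ζ) ^ s = -1 := by
    rw [incidenceDiagonal_pow]
    ext i j _
    rw [incidenceDiagonal_apply, IncidenceAlgebra.neg_apply, IncidenceAlgebra.one_apply]
    split_ifs <;> simp [hζs]
  have hDc : ∀ x, incidenceDiagonal (fun _ : ℕ ↦ ζ) * x = x * incidenceDiagonal fun _ ↦ ζ :=
    fun x ↦ by
      ext i j _
      rw [incidenceDiagonal_mul, mul_incidenceDiagonal, Subring.mem_center_iff.1 hζ]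
  have hD2 : incidenceDiagonal (fun _ : ℕ ↦ ζ) ^ (s * 2) = 1 := by
    rw [incidenceDiagonal_pow]
    ext i j _
    rw [incidenceDiagonal_apply, IncidenceAlgebra.one_apply]
    split_ifs
    · rw [pow_mul, hζs, neg_one_sq]
    · rfl
  refine ((h.map (RingHom.id _) (fun _ hx ↦ hx) fun _ hx ↦ hx.pmUTInf).mul_central
    (Units.ofPowEqOne _ (s * 2) hD2 (by omega)) hDc fun x hx ↦ ⟨⟨fun i j hij hj ↦ ?_,
      fun i ↦ Or.inr ?_⟩, ?_⟩)
  · change (incidenceDiagonal (fun _ ↦ ζ) * x) i j = 0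
    rw [incidenceDiagonal_mul, hx.1.1 i j hij hj, mul_zero]
  · change (incidenceDiagonal (fun _ ↦ ζ) * x) i i ^ s = -1
    have hc : Commute ζ (x i i) := (Subring.mem_center_iff.1 hζ _).symm
    rw [incidenceDiagonal_mul, hc.mul_pow, hζs, hx.1.2, mul_one]
  · change (incidenceDiagonal (fun _ ↦ ζ) * x) ^ s = -1
    rw [Commute.mul_pow (hDc x), hD, hx.2, mul_one]

end InfiniteCase

/-! ### Finite matrices as corners of infinite ones -/

section FiniteCase

variable {R : Type*} [Ring R]

lemma exists_cornerHom_eq {n m : ℕ} {A : Matrix (Fin n) (Fin n) R} (hA : A ∈ UTFin R n m) :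
    ∃ B ∈ UTInf R m, cornerHom n B = A := by
  have happ : ∀ i j (hi : i < n) (hj : j < n), i ≤ j → incidenceOfFun (fun i j ↦
      if h : i < n ∧ j < n then A ⟨i, h.1⟩ ⟨j, h.2⟩ else if i = j then 1 else 0) i j =
      A ⟨i, hi⟩ ⟨j, hj⟩ := fun i j hi hj hij ↦ by
    rw [incidenceOfFun_apply _ hij, dif_pos ⟨hi, hj⟩]
  refine ⟨incidenceOfFun fun i j ↦ if h : i < n ∧ j < n then A ⟨i, h.1⟩ ⟨j, h.2⟩
    else if i = j then 1 else 0, ⟨fun i j hij hj ↦ ?_, fun i ↦ ?_⟩, ?_⟩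
  · rw [incidenceOfFun_apply _ hij.le]
    split_ifs with h h'
    · exact hA.1.2 _ _ hij hj
    · omega
    · rfl
  · rw [incidenceOfFun_apply _ le_rfl]
    by_cases h : i < n ∧ i < n
    · rw [dif_pos h, hA.2]
    · rw [dif_neg h, if_pos rfl]
  · ext i j
    rcases lt_or_ge j i with h | h
    · rw [hA.1.1 i j h, cornerHom_apply,
        IncidenceAlgebra.apply_eq_zero_of_not_le (by omega : ¬ (i : ℕ) ≤ j)]
    · exact happ i j i.2 j.2 h

lemma cornerHom_mem_TFin {n m : ℕ} {g : IncidenceAlgebra R ℕ} (hg : g ∈ TInf R m) :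
    cornerHom n g ∈ TFin R n m :=
  ⟨fun i j h ↦ by
    rw [cornerHom_apply, IncidenceAlgebra.apply_eq_zero_of_not_le (by omega : ¬ (i : ℕ) ≤ j)],
    fun i j h h' ↦ hg i j h h'⟩

lemma HasOrderIn.cornerHom_root {n m s : ℕ} {x : IncidenceAlgebra R ℕ}
    (hx : HasOrderIn (UTRootInf R s m) s x) : HasOrderIn (UTRootFin R n s m) s (cornerHom n x) :=
  ⟨⟨cornerHom_mem_TFin hx.1.1, fun i ↦ hx.1.2 i⟩, by rw [← map_pow, hx.2, map_one]⟩

lemma HasOrderIn.cornerHom_pm {n m s : ℕ} {x : IncidenceAlgebra R ℕ}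
    (hx : HasOrderIn (PMUTInf R s m) s x) : HasOrderIn (PMUTFin R n s m) s (cornerHom n x) :=
  ⟨⟨cornerHom_mem_TFin hx.1.1, fun i ↦ hx.1.2 i⟩, by rw [← map_pow, hx.2, map_one]⟩

lemma HasSkewOrderIn.cornerHom_pm {n m s : ℕ} {x : IncidenceAlgebra R ℕ}
    (hx : HasSkewOrderIn (PMUTInf R s m) s x) :
    HasSkewOrderIn (PMUTFin R n s m) s (cornerHom n x) :=
  ⟨⟨cornerHom_mem_TFin hx.1.1, fun i ↦ hx.1.2 i⟩, by rw [← map_pow, hx.2, map_neg, map_one]⟩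

end FiniteCase

theorem theorem1p1 (R : Type*) [Ring R] (m : ℕ) (hm : 1 ≤ m) :
    -- two commutators of involutions
    (IsUnit (2 : R) →
      (∀ A ∈ UTInf R m,
        IsProdOfCommutators 2
          (HasOrderIn (PMUTInf R 2 m) 2) (HasOrderIn (PMUTInf R 2 m) 2) A) ∧
      (∀ n : ℕ, ∀ A ∈ UTFin R n m,
        IsProdOfCommutators 2
          (HasOrderIn (PMUTFin R n 2 m) 2) (HasOrderIn (PMUTFin R n 2 m) 2) A)) ∧
    -- two commutators of a skew-involution and an involution
    (IsUnit (2 : R) → ∀ ι ∈ Subring.center R, ι ^ 2 = -1 →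
      (∀ A ∈ UTInf R m,
        IsProdOfCommutators 2
          (HasSkewOrderIn (PMUTInf R 2 m) 2) (HasOrderIn (PMUTInf R 2 m) 2) A) ∧
      (∀ n : ℕ, ∀ A ∈ UTFin R n m,
        IsProdOfCommutators 2
          (HasSkewOrderIn (PMUTFin R n 2 m) 2) (HasOrderIn (PMUTFin R n 2 m) 2) A)) ∧
    -- `4k - 6` commutators of matrices of order `k`
    (∀ k : ℕ, 2 ≤ k → IsUnit (k : R) →
      ∀ ω ∈ Subring.center R, ∑ j ∈ Finset.range k, ω ^ j = 0 →
      (∀ A ∈ UTInf R m,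
        IsProdOfCommutators (4 * k - 6)
          (HasOrderIn (UTRootInf R k m) k) (HasOrderIn (UTRootInf R k m) k) A) ∧
      (∀ n : ℕ, ∀ A ∈ UTFin R n m,
        IsProdOfCommutators (4 * k - 6)
          (HasOrderIn (UTRootFin R n k m) k) (HasOrderIn (UTRootFin R n k m) k) A)) ∧
    -- `8k - 6` commutators of a matrix of skew order `2k` and a matrix of order `2k`
    (∀ k : ℕ, 2 ≤ k → IsUnit ((2 * k : ℕ) : R) →
      ∀ ζ ∈ Subring.center R, ζ ^ (2 * k) = -1 →
      (∀ A ∈ UTInf R m,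
        IsProdOfCommutators (8 * k - 6)
          (HasSkewOrderIn (PMUTInf R (2 * k) m) (2 * k))
          (HasOrderIn (PMUTInf R (2 * k) m) (2 * k)) A) ∧
      (∀ n : ℕ, ∀ A ∈ UTFin R n m,
        IsProdOfCommutators (8 * k - 6)
          (HasSkewOrderIn (PMUTFin R n (2 * k) m) (2 * k))
          (HasOrderIn (PMUTFin R n (2 * k) m) (2 * k)) A)) := by
  have hneg : (-1 : R) ∈ Subring.center R := neg_mem (one_mem _)
  have hsum : ∑ j ∈ Finset.range 2, (-1 : R) ^ j = 0 := by simp [Finset.sum_range_succ]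
  have two : IsUnit (2 : R) → ∀ A ∈ UTInf R m, IsProdOfCommutators 2
      (HasOrderIn (UTRootInf R 2 m) 2) (HasOrderIn (UTRootInf R 2 m) 2) A := fun h A hA ↦
    isProdOfCommutators_UTInf hm le_rfl (by exact_mod_cast h) hneg hsum hA
  refine ⟨fun h ↦ ?_, fun h ι hι hι2 ↦ ?_, fun k hk hkR ω hω hω0 ↦ ?_,
    fun k hk hkR ζ hζ hζk ↦ ?_⟩
  · have hinf : ∀ A ∈ UTInf R m, IsProdOfCommutators 2
        (HasOrderIn (PMUTInf R 2 m) 2) (HasOrderIn (PMUTInf R 2 m) 2) A := fun A hA ↦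
      (two h A hA).map (RingHom.id _) (fun _ hx ↦ hx.pmUTInf) fun _ hx ↦ hx.pmUTInf
    refine ⟨hinf, fun n A hA ↦ ?_⟩
    obtain ⟨B, hB, rfl⟩ := exists_cornerHom_eq hA
    exact (hinf B hB).map _ (fun _ hx ↦ hx.cornerHom_pm) fun _ hx ↦ hx.cornerHom_pm
  · have hinf := fun A hA ↦ (two h A hA).skew hι two_ne_zero hι2
    refine ⟨hinf, fun n A hA ↦ ?_⟩
    obtain ⟨B, hB, rfl⟩ := exists_cornerHom_eq hA
    exact (hinf B hB).map _ (fun _ hx ↦ hx.cornerHom_pm) fun _ hx ↦ hx.cornerHom_pm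
  · have hinf := fun A (hA : A ∈ UTInf R m) ↦ isProdOfCommutators_UTInf hm hk hkR hω hω0 hA
    refine ⟨hinf, fun n A hA ↦ ?_⟩
    obtain ⟨B, hB, rfl⟩ := exists_cornerHom_eq hA
    exact (hinf B hB).map _ (fun _ hx ↦ hx.cornerHom_root) fun _ hx ↦ hx.cornerHom_root
  · -- `ω = ζ ^ 2` satisfies `ω ^ k = -1`, hence `1 + ω + ⋯ + ω ^ (2 k - 1) = 0`
    have hω0 : ∑ j ∈ Finset.range (2 * k), (ζ ^ 2) ^ j = 0 := by
      rw [two_mul, Finset.sum_range_add]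
      simp only [pow_add]
      rw [← Finset.mul_sum, ← pow_mul, hζk, neg_one_mul, add_neg_cancel]
    have hinf : ∀ A ∈ UTInf R m, IsProdOfCommutators (8 * k - 6)
        (HasSkewOrderIn (PMUTInf R (2 * k) m) (2 * k))
        (HasOrderIn (PMUTInf R (2 * k) m) (2 * k)) A := fun A hA ↦
      ((isProdOfCommutators_UTInf hm (by omega) hkR (pow_mem hζ 2) hω0 hA).mono
        (by omega)).skew hζ (by omega) hζk
    refine ⟨hinf, fun n A hA ↦ ?_⟩
    obtain ⟨B, hB, rfl⟩ := exists_cornerHom_eq hA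
    exact (hinf B hB).map _ (fun _ hx ↦ hx.cornerHom_pm) fun _ hx ↦ hx.cornerHom_pm
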